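/- **Setting.** Let $d\ge 1$, $l>0$. For Hermitian $A,B\in\mathbb C^{d\times d}$ write $\langle A,B\rangle=\mathrm{tr}(AB)$, $f(A)=\sum_i f(\lambda_i)v_iv_i^*$ for $A=\sum_i\lambda_iv_iv_i^*$, $\|A\|_{op}$ for the Euclidean operator norm, and $\Delta_{d\times d}$ for the set of positive semidefinite matrices of trace one. In matrix LEA, in each round $t=1,2,\dots$ the learner predicts $X_t\in\Delta_{d\times d}$ and then receives a Hermitian loss matrix $G_t$ with $\|G_t\|_{op}\le l$; $\mathrm{Reg}_T(X)=\sum_{t=1}^T\langle G_t,X_t\rangle-\sum_{t=1}^T\langle G_t,X\rangle$, and $S(X\|Y)=\langle X,\log X-\log Y\rangle$ (with $0\log 0=0$). **Algorithm.** Put $\varepsilon=2l$, $$\Phi_t(s)=\frac{\varepsilon\sqrt t}{d}\Big[2\int_0^{s/\sqrt{2\varepsilon^2t}}\Big(\int_0^u e^{x^2}\,dx\Big)du-1\Big],$$ and $S_1=0$. In round $t$ compute $\tilde X_t=\frac1{2\varepsilon}[\Phi_t(S_t+\varepsilon I)-\Phi_t(S_t-\varepsilon I)]=\sum_i\lambda_iv_iv_i^*$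 and predict $X_t=\sum_i\max\{0,\lambda_i\}v_iv_i^*\big/\sum_i\max\{0,\lambda_i\}$, or $X_t=d^{-1}I_d$ if no $\lambda_i$ is positive. After receiving $G_t$ put $\bar G_t=G_t-\langle G_t,X_t\rangle I_d$; if all $\lambda_i\ge 0$ put $\tilde G_t=\bar G_t$, and otherwise $\tilde G_t=\bar G_t-\min\{0,\langle\bar G_t,U_t\rangle\}U_t$ with $U_t=\sum_i\min\{0,\lambda_i\}v_iv_i^*\big/\big|\sum_i\min\{0,\lambda_i\}\big|$. Finally put $S_{t+1}=S_t-\tilde G_t$. **Theorem.** 1. This is a matrix LEA algorithm: for all $d\ge1$, $l>0$, $T\ge 1$ and all Hermitian $G_1,\dots,G_T$ with $\|G_t\|_{op}\le l$, all the predictions $X_1,\dots,X_T$ lie in $\Delta_{d\times d}$; and for every $X\in\Delta_{d\times d}$, $$\mathrm{Reg}_T(X)\le l\sqrt T\Big[\sqrt{8\,S(X\|d^{-1}I_d)}+6+2\sqrt2\Big].$$ 2. In particular there is an absolute constant $C$ such that always $\mathrm{Reg}_T(X)\le C\,l\sqrt{T\cdot\max\{1,S(X\|d^{-1}I_d)\}}$,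 which is $O\big(\sqrt{T\cdot S(X\|d^{-1}I_d)}\big)$ as long as $S(X\|d^{-1}I_d)$ is bounded away from $0$. 3. Its per-round time and its memory are, up to an absolute constant factor in both directions, those of MMWU, the algorithm that predicts $\exp(-\eta_t\sum_{i<t}G_i)\big/\mathrm{tr}\exp(-\eta_t\sum_{i<t}G_i)$ for given learning rates $\eta_t$. Here computations are straight-line programs, the same for all $d$, in exact real arithmetic, with registers for real numbers, real $d$-vectors and complex $d\times d$ matrices. The instructions are rational constants, the identity matrix and constant vectors; $+,-,\times,/$ (with $x/0=0$), $\max$, $\min$ and comparison of numbers or, entrywise, of vectors; summing the entries of a vector; sums, differences, scalar multiples and inner products of matrices; evaluations of $\exp$, $\sqrt{\cdot}$ and $y\mapsto\int_0^ye^{u^2}du$ on numbers or entrywise on vectors; an eigen-decomposition oracle for Hermitian matrices; and forming $V\mathrm{diag}(v)V^*$. Operations on numbers, vectors and matrices take time $1$, $d$ and $d^2$; an eigen-decomposition, forming $V\mathrm{diag}(v)V^*$, and each function evaluation have arbitrary nonnegative integer prices; memory is the total size of the registers used. MMWU is implemented by the standard program $Q$ that makes in each round one eigen-decomposition of $\sum_{i<t}G_i$,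 computes the entries $e^{-\eta_t\lambda_i}/\sum_je^{-\eta_t\lambda_j}$, forms $V\mathrm{diag}(\cdot)V^*$, and adds $G_t$ to the sum (that $Q$ computes the MMWU predictions is part of the claim). Then there are one program $P$ and one constant $C$ such that for all $d\ge1$ and $l>0$ the program $P$, given $t$, $d$ and $l$, computes the predictions $X_t$ of the algorithm above for all Hermitian losses and all eigen-decompositions that the oracle may return, and such that for all $d\ge1$ and all prices $\mathrm{time}(P)\le C\,\mathrm{time}(Q)$, $\mathrm{time}(Q)\le C\,\mathrm{time}(P)$, $\mathrm{space}(P)\le C\,\mathrm{space}(Q)$ and $\mathrm{space}(Q)\le C\,\mathrm{space}(P)$. -/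

import Mathlib

noncomputable section

open scoped ComplexOrder

namespace MatrixLEA

/-! ### Matrices, spectraplex, relative entropy -/

/-- Complex `d × d` matrices. -/
abbrev CMat (d : ℕ) : Type := Matrix (Fin d) (Fin d) ℂ

/-- The inner product `⟨A, B⟩ = tr(A B)` of Hermitian matrices (a real number for Hermitian
`A`, `B`, whence the real part). -/
def frob {d : ℕ} (A B : CMat d) : ℝ := (A * B).trace.re

/-- The Euclidean operator norm of a matrix. -/
def opNorm {d : ℕ} (A : CMat d) : ℝ := ‖Matrix.toEuclideanCLM (n := Fin d) (𝕜 := ℂ) A‖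

/-- The spectraplex: positive semidefinite (hence Hermitian) matrices of trace one. -/
def spectraplex (d : ℕ) : Set (CMat d) := {X | X.PosSemidef ∧ X.trace = 1}

/-- The maximally mixed state `d⁻¹ I`. -/
def maxMixed (d : ℕ) : CMat d := ((d : ℝ)⁻¹) • (1 : CMat d)

/-- Quantum relative entropy `S(X ‖ Y) = ⟨X, log X - log Y⟩`, for `X` positive semidefinite and
`Y` positive definite. Spectral functions `f(A) = ∑ f(λᵢ) vᵢ vᵢ*` of a Hermitian matrix are
written `cfc f A`; since `Real.log 0 = 0`, the convention `0 log 0 = 0` is built in. -/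
def relEntropy {d : ℕ} (X Y : CMat d) : ℝ := frob X (cfc Real.log X - cfc Real.log Y)

/-! ### Online algorithms -/

/-- A deterministic online algorithm whose predictions and losses are `d × d` matrices. In round
`t = 1, 2, …` it predicts `predict t s` from its current state `s`, then it receives the loss
matrix `G` of that round and moves to the state `update t s G`. -/
structure OnlineAlgorithm (d : ℕ) where
  State : Type
  init : State
  predict : ℕ → State → CMat d
  update : ℕ → State → CMat d → State

/-- The state after `n` rounds, against the losses `G 1, G 2, …` (`G 0` is not used). -/
def OnlineAlgorithm.stateAfter {d : ℕ} (A : OnlineAlgorithm d) (G : ℕ → CMat d) : ℕ → A.State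
  | 0 => A.init
  | n + 1 => A.update (n + 1) (A.stateAfter G n) (G (n + 1))

/-- The prediction of round `t ≥ 1` against the losses `G`; it depends on `G 1, …, G (t - 1)`. -/
def OnlineAlgorithm.play {d : ℕ} (A : OnlineAlgorithm d) (G : ℕ → CMat d) (t : ℕ) : CMat d :=
  A.predict t (A.stateAfter G (t - 1))

/-- The regret `∑_{t=1}^T ⟨G_t, X_t⟩ - ∑_{t=1}^T ⟨G_t, X⟩` of predictions `Xs` against the
comparator `X`. -/
def regret {d : ℕ} (G Xs : ℕ → CMat d) (T : ℕ) (X : CMat d) : ℝ :=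
  ∑ t ∈ Finset.Icc 1 T, frob (G t) (Xs t) - ∑ t ∈ Finset.Icc 1 T, frob (G t) X

/-- The unconstrained potential algorithm on Hermitian matrices: with `S_t = -∑_{i<t} G_i`, it
outputs `(2ε)⁻¹ [Φ_t(S_t + ε I) - Φ_t(S_t - ε I)]`. -/
def potentialAlgorithm (d : ℕ) (ε : ℝ) (Φ : ℕ → ℝ → ℝ) : OnlineAlgorithm d where
  State := CMat d
  init := 0
  predict t S :=
    ((2 * ε)⁻¹ : ℝ) • (cfc (Φ t) (S + ε • (1 : CMat d)) - cfc (Φ t) (S - ε • (1 : CMat d)))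
  update _ S G := S - G

/-- `∑ max{0, λᵢ} vᵢ vᵢ*`. -/
def posPart {d : ℕ} (A : CMat d) : CMat d := cfc (fun x : ℝ => max 0 x) A

/-- `∑ min{0, λᵢ} vᵢ vᵢ*`. -/
def negPart {d : ℕ} (A : CMat d) : CMat d := cfc (fun x : ℝ => min 0 x) A

open Classical in
/-- The spectraplex prediction made from the base prediction `A`: the positive part of `A`
divided by its trace; if the positive part vanishes (as in the first round), where this quotient
has no meaning, the prediction is `d⁻¹ I`. -/
def normalizedPos {d : ℕ} (A : CMat d) : CMat d :=
  if posPart A = 0 then maxMixed d else ((posPart A).trace.re)⁻¹ • posPart A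

/-- `U = (∑ min{0, λᵢ} vᵢ vᵢ*) / |∑ min{0, λᵢ}|`, used only if some `λᵢ < 0`. -/
def negDirection {d : ℕ} (A : CMat d) : CMat d := |(negPart A).trace.re|⁻¹ • negPart A

open Classical in
/-- The surrogate loss made from the base prediction `A` and the loss matrix `G`. -/
def surrogateLoss {d : ℕ} (A G : CMat d) : CMat d :=
  let Gbar : CMat d := G - frob G (normalizedPos A) • (1 : CMat d)
  if A.PosSemidef then Gbar
  else Gbar - min 0 (frob Gbar (negDirection A)) • negDirection A

/-- The reduction of matrix LEA to a base algorithm on Hermitian matrices. -/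
def reduction {d : ℕ} (A : OnlineAlgorithm d) : OnlineAlgorithm d where
  State := A.State
  init := A.init
  predict t s := normalizedPos (A.predict t s)
  update t s G := A.update t s (surrogateLoss (A.predict t s) G)

/-- The scaled imaginary error function `∫₀^y exp(u²) du`. -/
def erfiInt (y : ℝ) : ℝ := ∫ u in (0 : ℝ)..y, Real.exp (u ^ 2)

/-- The erfi potential
`Φ_t(s) = (ε √t / d) [2 ∫₀^{s/√(2ε²t)} (∫₀^u exp(x²) dx) du - 1]`. -/
def erfiPotential (d : ℕ) (ε : ℝ) (t : ℕ) (s : ℝ) : ℝ :=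
  ε * √(t : ℝ) / d * (2 * (∫ u in (0 : ℝ)..(s / √(2 * ε ^ 2 * t)), erfiInt u) - 1)

/-- The matrix LEA algorithm for losses of operator norm at most `l`: the reduction, run with the
potential algorithm of the erfi potential and `ε = 2 l` as its base. -/
def erfiLEA (d : ℕ) (l : ℝ) : OnlineAlgorithm d :=
  reduction (potentialAlgorithm d (2 * l) (erfiPotential d (2 * l)))

/-- Matrix multiplicative weight update with learning rates `η t`: with `S = ∑_{i<t} G_i`, the
prediction is `exp(-η_t S) / tr exp(-η_t S)`. -/
def mmwu (d : ℕ) (η : ℕ → ℝ) : OnlineAlgorithm d where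
  State := CMat d
  init := 0
  predict t S :=
    ((cfc Real.exp ((-η t) • S)).trace.re)⁻¹ • cfc Real.exp ((-η t) • S)
  update _ S G := S + G

/-! ### A machine model with time and memory

Exact real arithmetic, with registers for real numbers, for real vectors of length `d` and for
complex `d × d` matrices. Programs are straight-line codes that do not depend on `d`. -/

/-- Binary operations on real numbers, at unit cost. `lt` is the comparison, with value `1` if the
first argument is smaller and `0` otherwise; a division by zero returns `0`. -/
inductive BinOp
  | add | sub | mul | div | max | min | lt

/-- The value of a binary operation. -/
def BinOp.eval : BinOp → ℝ → ℝ → ℝ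
  | .add, x, y => x + y
  | .sub, x, y => x - y
  | .mul, x, y => x * y
  | .div, x, y => x / y
  | .max, x, y => Max.max x y
  | .min, x, y => Min.min x y
  | .lt, x, y => open Classical in if x < y then 1 else 0

/-- Transcendental and algebraic functions of one real variable. -/
inductive Fn
  | exp | sqrt | erfi

/-- The value of a function. -/
def Fn.eval : Fn → ℝ → ℝ
  | .exp, x => Real.exp x
  | .sqrt, x => √x
  | .erfi, x => erfiInt x

/-- Instructions; the first register (for `eig`, the first two registers) is the target. -/
inductive Instr
  /-- scalar `k` := the constant `q` -/
  | const (k : ℕ) (q : ℚ)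
  /-- scalar `k` := `o` (scalar `i`) (scalar `j`) -/
  | scalOp (k : ℕ) (o : BinOp) (i j : ℕ)
  /-- scalar `k` := `f` (scalar `i`) -/
  | scalFn (k : ℕ) (f : Fn) (i : ℕ)
  /-- vector `k` := the vector all of whose entries are scalar `i` -/
  | vecFill (k i : ℕ)
  /-- vector `k` := entrywise `o` of the vectors `i`, `j` -/
  | vecOp (k : ℕ) (o : BinOp) (i j : ℕ)
  /-- vector `k` := entrywise `f` of the vector `i` -/
  | vecFn (k : ℕ) (f : Fn) (i : ℕ)
  /-- scalar `k` := the sum of the entries of vector `i` -/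
  | vecSum (k i : ℕ)
  /-- matrix `k` := the identity matrix -/
  | matOne (k : ℕ)
  /-- matrix `k` := matrix `i` + matrix `j` -/
  | matAdd (k i j : ℕ)
  /-- matrix `k` := matrix `i` - matrix `j` -/
  | matSub (k i j : ℕ)
  /-- matrix `k` := scalar `i` times matrix `j` -/
  | matSmul (k i j : ℕ)
  /-- scalar `k` := the inner product of the matrices `i` and `j` -/
  | matInner (k i j : ℕ)
  /-- vector `kv` and matrix `km` := eigenvalues and eigenvectors of matrix `i` -/
  | eig (kv km i : ℕ)
  /-- matrix `k` := `V diag(v) V*`, for the matrix `V` in `i` and the vector `v` in `j` -/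
  | synth (k i j : ℕ)

/-- The contents of the registers. -/
structure Mem (d : ℕ) where
  scal : ℕ → ℝ
  vec : ℕ → Fin d → ℝ
  mat : ℕ → CMat d

/-- An eigen-decomposition oracle: for every Hermitian `A` it returns some real eigenvalues and
some unitary matrix `V` of eigenvectors, with `A = V diag(λ) V*`. -/
structure EigOracle (d : ℕ) where
  vals : CMat d → Fin d → ℝ
  vecs : CMat d → CMat d
  unitary : ∀ A : CMat d, A.IsHermitian → vecs A ∈ Matrix.unitaryGroup (Fin d) ℂ
  spec : ∀ A : CMat d, A.IsHermitian →
    A = vecs A * Matrix.diagonal (fun i => (vals A i : ℂ)) * (vecs A).conjTranspose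

/-- Eigen-decomposition oracles exist. -/
theorem EigOracle.nonempty (d : ℕ) : Nonempty (EigOracle d) := by
  classical
  refine ⟨⟨fun A => if h : A.IsHermitian then h.eigenvalues else 0,
    fun A => if h : A.IsHermitian then (h.eigenvectorUnitary : CMat d) else 0, ?_, ?_⟩⟩
  · intro A h
    simp only [dif_pos h]
    exact h.eigenvectorUnitary.2
  · intro A h
    simp only [dif_pos h]
    exact h.spectral_theorem

/-- The effect of an instruction. -/
def Instr.exec {d : ℕ} (O : EigOracle d) (m : Mem d) : Instr → Mem d
  | .const k q => { m with scal := Function.update m.scal k (q : ℝ) }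
  | .scalOp k o i j => { m with scal := Function.update m.scal k (o.eval (m.scal i) (m.scal j)) }
  | .scalFn k f i => { m with scal := Function.update m.scal k (f.eval (m.scal i)) }
  | .vecFill k i => { m with vec := Function.update m.vec k (fun _ => m.scal i) }
  | .vecOp k o i j =>
      { m with vec := Function.update m.vec k (fun a => o.eval (m.vec i a) (m.vec j a)) }
  | .vecFn k f i => { m with vec := Function.update m.vec k (fun a => f.eval (m.vec i a)) }
  | .vecSum k i => { m with scal := Function.update m.scal k (∑ a, m.vec i a) }
  | .matOne k => { m with mat := Function.update m.mat k 1 }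
  | .matAdd k i j => { m with mat := Function.update m.mat k (m.mat i + m.mat j) }
  | .matSub k i j => { m with mat := Function.update m.mat k (m.mat i - m.mat j) }
  | .matSmul k i j => { m with mat := Function.update m.mat k (m.scal i • m.mat j) }
  | .matInner k i j => { m with scal := Function.update m.scal k (frob (m.mat i) (m.mat j)) }
  | .eig kv km i =>
      { m with
        vec := Function.update m.vec kv (O.vals (m.mat i))
        mat := Function.update m.mat km (O.vecs (m.mat i)) }
  | .synth k i j =>
      { m with
        mat := Function.update m.mat k
          (m.mat i * Matrix.diagonal (fun a => (m.vec j a : ℂ)) * (m.mat i).conjTranspose) }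

/-- The prices, in dimension `d`, of an eigen-decomposition, of forming `V diag(v) V*` (a matrix
multiplication), and of one evaluation of a function in `Fn`. -/
structure Prices where
  eig : ℕ
  synth : ℕ
  fn : ℕ

/-- The time of an instruction: the number of entries it computes with, or its price. -/
def Instr.time (d : ℕ) (p : Prices) : Instr → ℕ
  | .const _ _ => 1
  | .scalOp _ _ _ _ => 1
  | .scalFn _ _ _ => p.fn
  | .vecFill _ _ => d
  | .vecOp _ _ _ _ => d
  | .vecFn _ _ _ => d * p.fn
  | .vecSum _ _ => d
  | .matOne _ => d ^ 2
  | .matAdd _ _ _ => d ^ 2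
  | .matSub _ _ _ => d ^ 2
  | .matSmul _ _ _ => d ^ 2
  | .matInner _ _ _ => d ^ 2
  | .eig _ _ _ => p.eig
  | .synth _ _ _ => p.synth

/-- The scalar registers that an instruction mentions. -/
def Instr.scalRegs : Instr → Finset ℕ
  | .const k _ => {k}
  | .scalOp k _ i j => {k, i, j}
  | .scalFn k _ i => {k, i}
  | .vecFill _ i => {i}
  | .vecSum k _ => {k}
  | .matSmul _ i _ => {i}
  | .matInner k _ _ => {k}
  | _ => ∅

/-- The vector registers that an instruction mentions. -/
def Instr.vecRegs : Instr → Finset ℕ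
  | .vecFill k _ => {k}
  | .vecOp k _ i j => {k, i, j}
  | .vecFn k _ i => {k, i}
  | .vecSum _ i => {i}
  | .eig kv _ _ => {kv}
  | .synth _ _ j => {j}
  | _ => ∅

/-- The matrix registers that an instruction mentions. -/
def Instr.matRegs : Instr → Finset ℕ
  | .matOne k => {k}
  | .matAdd k i j => {k, i, j}
  | .matSub k i j => {k, i, j}
  | .matSmul k _ j => {k, j}
  | .matInner _ i j => {i, j}
  | .eig _ km i => {km, i}
  | .synth k i _ => {k, i}
  | _ => ∅

/-- A program for an online algorithm: in each round the code `predict` is run, the prediction is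
read off, the loss matrix is written into the memory, and the code `update` is run. -/
structure Program where
  predict : List Instr
  update : List Instr

/-- Running a straight-line code. -/
def execList {d : ℕ} (O : EigOracle d) (code : List Instr) (m : Mem d) : Mem d :=
  code.foldl (fun m c => c.exec O m) m

/-- The running time of one round (the same for all rounds, as codes are straight-line). -/
def Program.time (P : Program) (d : ℕ) (p : Prices) : ℕ :=
  ((P.predict ++ P.update).map (Instr.time d p)).sum

/-- The registers, of the kind given by `regs`, that a code mentions. -/
def regsOf (regs : Instr → Finset ℕ) (code : List Instr) : Finset ℕ :=
  code.foldr (fun c s => regs c ∪ s) ∅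

/-- The number of real or complex numbers in the registers that the program uses. -/
def Program.space (P : Program) (d : ℕ) : ℕ :=
  (regsOf Instr.scalRegs (P.predict ++ P.update)).card
    + d * (regsOf Instr.vecRegs (P.predict ++ P.update)).card
    + d ^ 2 * (regsOf Instr.matRegs (P.predict ++ P.update)).card

/-- At the start of round `t`, the round number `t`, the dimension `d` and a parameter `a` are
written into the scalar registers `0`, `1` and `2`. -/
def Mem.startRound {d : ℕ} (m : Mem d) (t : ℕ) (a : ℝ) : Mem d :=
  { m with
    scal := Function.update (Function.update (Function.update m.scal 0 (t : ℝ)) 1 (d : ℝ)) 2 a }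

/-- The loss matrix is written into the matrix register `1`. -/
def Mem.receive {d : ℕ} (m : Mem d) (G : CMat d) : Mem d :=
  { m with mat := Function.update m.mat 1 G }

/-- The memory after `n` rounds, from a memory full of zeros; in round `t` the parameter is
`a t`. -/
def Program.memAfter (P : Program) {d : ℕ} (O : EigOracle d) (a : ℕ → ℝ) (G : ℕ → CMat d) :
    ℕ → Mem d
  | 0 => ⟨fun _ => 0, fun _ => 0, fun _ => 0⟩
  | n + 1 =>
      execList O P.update
        ((execList O P.predict ((P.memAfter O a G n).startRound (n + 1) (a (n + 1)))).receive
          (G (n + 1)))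

/-- The prediction in round `t ≥ 1`, read off the matrix register `0`. -/
def Program.output (P : Program) {d : ℕ} (O : EigOracle d) (a : ℕ → ℝ) (G : ℕ → CMat d)
    (t : ℕ) : CMat d :=
  (execList O P.predict ((P.memAfter O a G (t - 1)).startRound t (a t))).mat 0

/-- With parameters `a`, the program makes the same predictions as the algorithm `A`, whatever the
Hermitian losses are and whichever eigen-decompositions the oracle returns. -/
def Program.Implements (P : Program) {d : ℕ} (a : ℕ → ℝ) (A : OnlineAlgorithm d) : Prop :=
  ∀ (O : EigOracle d) (G : ℕ → CMat d), (∀ t, (G t).IsHermitian) →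
    ∀ t, 1 ≤ t → P.output O a G t = A.play G t

/-- The program for matrix multiplicative weight update: with `S = ∑_{i<t} G_i` in the matrix
register `2` and the learning rate `η` as parameter, it makes an eigen-decomposition of `S`, forms
the entries `exp(-η λᵢ) / ∑ⱼ exp(-η λⱼ)`, and returns to the matrix form; the update is
`S + G`. -/
def mmwuProgram : Program where
  predict :=
    [.eig 0 3 2,
     .const 3 0,
     .scalOp 3 .sub 3 2,
     .vecFill 1 3,
     .vecOp 0 .mul 1 0,
     .vecFn 0 .exp 0,
     .vecSum 3 0,
     .vecFill 1 3,
     .vecOp 0 .div 0 1,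
     .synth 0 3 0]
  update := [.matAdd 2 2 1]

end MatrixLEA

end

open MatrixLEA

noncomputable section

open scoped ComplexOrder

namespace MatrixLEA

/-! ### Spectral calculus in explicit eigen-decompositions -/

/-! Regret. The reduction centres each loss and corrects it along a negative direction `U`, so that
the surrogate loss has norm at most `2 * l`, is orthogonal to the positive part of the base
prediction, and dominates the linearized regret (`surrogateLoss_spec`). Hence the regret is at most
`⟨S, X⟩` for the final state `S`, and it remains to control `S` through a potential.

The potential used is `tr Φ_t(S₊)`, with the spectrum truncated at zero. It never becomes positive
(`erfiState_spec`): a round changes it by at most a term linear in the surrogate loss, and that term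
vanishes by the orthogonality. The one-round bound `tracePotential_le` has two ingredients. The
scalar one is a discrete Itô inequality: averaging `Φ_{t+1}` over `s ± ε` does not exceed `Φ_t(s)`.
The matrix one, `trace_erfiProfile_add_le`, is a chord bound: for `-ε I ≤ C ≤ ε I`, `tr Φ(A + C)` is
at most the mean of `tr Φ(A ± ε I)` plus the divided-difference term linear in `C`. Mere convexity
of `Φ` is not what is used for it. For exponentials it follows from a differential inequality for
`tr exp` along a line (`trace_exp_add_smul_le`); a Gaussian mixture of exponentials carries it to
`exp(θ x²)`, and an integration in the scale parameter carries it to the erfi profile.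

Finally, a nonpositive potential bounds the average over eigenvalues of an exponential of squares,
so the Gibbs variational principle and Cauchy–Schwarz bound `⟨S, X⟩` by the square root of the
relative entropy (`frob_le_of_tracePotential_nonpos`).

All these trace inequalities are reduced to scalar ones by the doubly stochastic weights `|⟨v_i,
w_j⟩|²` of two eigenbases.

Complexity. All matrices of one prediction share the eigenvectors of `S_t`, so one
eigen-decomposition per round suffices, and the potential has a closed form in `exp` and `erfiInt`.
Case distinctions are absorbed by `x / 0 = 0` and one comparison. -/

/-- The matrix `V diag(a) V*`. -/
def conjDiag {d : ℕ} (V : CMat d) (a : Fin d → ℝ) : CMat d :=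
  V * Matrix.diagonal (fun i => (a i : ℂ)) * V.conjTranspose

section ConjDiag

variable {d : ℕ} {V W : CMat d}

theorem conjTranspose_mul_self_of_unitary (hV : V ∈ Matrix.unitaryGroup (Fin d) ℂ) :
    V.conjTranspose * V = 1 := (Matrix.mem_unitaryGroup_iff').1 hV

theorem mul_conjTranspose_self_of_unitary (hV : V ∈ Matrix.unitaryGroup (Fin d) ℂ) :
    V * V.conjTranspose = 1 := (Matrix.mem_unitaryGroup_iff).1 hV

theorem conjDiag_isHermitian (V : CMat d) (a : Fin d → ℝ) : (conjDiag V a).IsHermitian := by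
  unfold conjDiag
  apply Matrix.isHermitian_mul_mul_conjTranspose
  rw [Matrix.isHermitian_diagonal_iff]
  intro i
  simp [IsSelfAdjoint]

theorem conjDiag_add (V : CMat d) (a b : Fin d → ℝ) :
    conjDiag V a + conjDiag V b = conjDiag V (fun i => a i + b i) := by
  simp only [conjDiag, Complex.ofReal_add, ← Matrix.diagonal_add, mul_add, add_mul]

theorem conjDiag_sub (V : CMat d) (a b : Fin d → ℝ) :
    conjDiag V a - conjDiag V b = conjDiag V (fun i => a i - b i) := by
  simp only [conjDiag, Complex.ofReal_sub, ← Matrix.diagonal_sub, mul_sub, sub_mul]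

theorem conjDiag_smul (V : CMat d) (r : ℝ) (a : Fin d → ℝ) :
    r • conjDiag V a = conjDiag V (fun i => r * a i) := by
  have : Matrix.diagonal (fun i => ((r * a i : ℝ) : ℂ))
      = r • Matrix.diagonal (fun i => (a i : ℂ)) := by
    ext i j
    by_cases h : i = j <;> simp [Matrix.diagonal, h]
  rw [conjDiag, conjDiag, this]
  simp

theorem conjDiag_const (hV : V ∈ Matrix.unitaryGroup (Fin d) ℂ) (r : ℝ) :
    conjDiag V (fun _ => r) = r • (1 : CMat d) := by
  have : conjDiag V (fun _ => r) = r • conjDiag V (fun _ => 1) := by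
    rw [conjDiag_smul]; simp
  rw [this]
  simp [conjDiag, mul_conjTranspose_self_of_unitary hV]

theorem conjDiag_mul (hV : V ∈ Matrix.unitaryGroup (Fin d) ℂ) (a b : Fin d → ℝ) :
    conjDiag V a * conjDiag V b = conjDiag V (fun i => a i * b i) := by
  have h := conjTranspose_mul_self_of_unitary hV
  calc conjDiag V a * conjDiag V b
      = V * Matrix.diagonal (fun i => (a i : ℂ)) * (V.conjTranspose * V)
          * Matrix.diagonal (fun i => (b i : ℂ)) * V.conjTranspose := by
        simp only [conjDiag, Matrix.mul_assoc]
    _ = _ := by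
        rw [h, Matrix.mul_one, Matrix.mul_assoc V, Matrix.diagonal_mul_diagonal]
        simp [conjDiag]

theorem trace_conjDiag (hV : V ∈ Matrix.unitaryGroup (Fin d) ℂ) (a : Fin d → ℝ) :
    (conjDiag V a).trace = ((∑ i, a i : ℝ) : ℂ) := by
  rw [conjDiag, Matrix.trace_mul_comm, ← Matrix.mul_assoc, conjTranspose_mul_self_of_unitary hV,
    Matrix.one_mul, Matrix.trace_diagonal]
  simp

theorem exists_eq_conjDiag {A : CMat d} (hA : A.IsHermitian) :
    ∃ V ∈ Matrix.unitaryGroup (Fin d) ℂ, ∃ a : Fin d → ℝ, A = conjDiag V a :=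
  ⟨hA.eigenvectorUnitary, hA.eigenvectorUnitary.2, hA.eigenvalues, hA.spectral_theorem⟩

theorem aeval_conjDiag (hV : V ∈ Matrix.unitaryGroup (Fin d) ℂ) (a : Fin d → ℝ)
    (p : Polynomial ℝ) :
    Polynomial.aeval (conjDiag V a) p = conjDiag V (fun i => p.eval (a i)) := by
  induction p using Polynomial.induction_on with
  | C r =>
    simp only [Polynomial.aeval_C, Polynomial.eval_C, conjDiag_const hV]
    exact Algebra.algebraMap_eq_smul_one r
  | add p q hp hq => simp [hp, hq, conjDiag_add]
  | monomial n r h =>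
    rw [pow_succ, ← mul_assoc, map_mul, h, Polynomial.aeval_X, conjDiag_mul hV]
    simp

/-- Spectral functions may be computed in any eigen-decomposition. -/
theorem cfc_conjDiag (hV : V ∈ Matrix.unitaryGroup (Fin d) ℂ) (f : ℝ → ℝ) (a : Fin d → ℝ) :
    cfc f (conjDiag V a) = conjDiag V (fun i => f (a i)) := by
  have hA := conjDiag_isHermitian V a
  set b := hA.eigenvalues with hb
  set U : CMat d := (hA.eigenvectorUnitary : CMat d) with hU
  have hUu : U ∈ Matrix.unitaryGroup (Fin d) ℂ := hA.eigenvectorUnitary.2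
  have h1 : cfc f (conjDiag V a) = conjDiag U (fun i => f (b i)) := by
    rw [hA.cfc_eq]; rfl
  have h2 : conjDiag V a = conjDiag U b := hA.spectral_theorem
  -- On the two finite lists of eigenvalues `f` agrees with one polynomial, and a polynomial in a
  -- matrix does not depend on the chosen diagonalization.
  set s : Finset ℝ := Finset.univ.image a ∪ Finset.univ.image b
  set p := Lagrange.interpolate s id f
  have hp : ∀ x ∈ s, p.eval x = f x := fun x hx =>
    Lagrange.eval_interpolate_at_node f (Set.injOn_id _) hx
  have h3 := aeval_conjDiag hV a p
  rw [h2, aeval_conjDiag hUu b p] at h3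
  have ha : ∀ i, p.eval (a i) = f (a i) := fun i => hp _ (by simp [s])
  have hb' : ∀ i, p.eval (b i) = f (b i) := fun i => hp _ (by simp [s])
  simp only [ha, hb'] at h3
  rw [h1, h3]

theorem conjDiag_injective (hV : V ∈ Matrix.unitaryGroup (Fin d) ℂ) {a b : Fin d → ℝ}
    (h : conjDiag V a = conjDiag V b) : a = b := by
  have key : ∀ c : Fin d → ℝ, V.conjTranspose * conjDiag V c * V
      = Matrix.diagonal (fun i => (c i : ℂ)) := by
    intro c
    have h := conjTranspose_mul_self_of_unitary hV
    calc V.conjTranspose * conjDiag V c * V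
        = (V.conjTranspose * V) * Matrix.diagonal (fun i => (c i : ℂ))
          * (V.conjTranspose * V) := by simp only [conjDiag, Matrix.mul_assoc]
      _ = _ := by rw [h]; simp
  have h' := key a
  rw [h, key b] at h'
  funext i
  have := congrFun (Matrix.diagonal_injective h') i
  exact_mod_cast this.symm

theorem posSemidef_conjDiag_iff (hV : V ∈ Matrix.unitaryGroup (Fin d) ℂ) (a : Fin d → ℝ) :
    (conjDiag V a).PosSemidef ↔ ∀ i, 0 ≤ a i := by
  have hu : IsUnit V := ⟨⟨V, V.conjTranspose, mul_conjTranspose_self_of_unitary hV,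
    conjTranspose_mul_self_of_unitary hV⟩, rfl⟩
  have := Matrix.IsUnit.posSemidef_star_right_conjugate_iff
    (x := Matrix.diagonal (fun i => (a i : ℂ))) hu
  rw [Matrix.star_eq_conjTranspose] at this
  rw [conjDiag, this, Matrix.posSemidef_diagonal_iff]
  simp

/-- The squared moduli of the inner products of two orthonormal bases. -/
def overlap (V W : CMat d) (i j : Fin d) : ℝ := Complex.normSq ((V.conjTranspose * W) i j)

theorem overlap_nonneg (V W : CMat d) (i j : Fin d) : 0 ≤ overlap V W i j := Complex.normSq_nonneg _

theorem sum_overlap_right (hV : V ∈ Matrix.unitaryGroup (Fin d) ℂ)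
    (hW : W ∈ Matrix.unitaryGroup (Fin d) ℂ) (i : Fin d) : ∑ j, overlap V W i j = 1 := by
  have h : (V.conjTranspose * W) * (V.conjTranspose * W).conjTranspose = 1 := by
    rw [Matrix.conjTranspose_mul, Matrix.conjTranspose_conjTranspose, Matrix.mul_assoc,
      ← Matrix.mul_assoc W, mul_conjTranspose_self_of_unitary hW, Matrix.one_mul,
      conjTranspose_mul_self_of_unitary hV]
  have h' := congrFun (congrFun h i) i
  rw [Matrix.mul_apply, Matrix.one_apply_eq] at h'
  simp only [Matrix.conjTranspose_apply, RCLike.star_def, Complex.mul_conj] at h'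
  exact_mod_cast h'

theorem sum_overlap_left (hV : V ∈ Matrix.unitaryGroup (Fin d) ℂ)
    (hW : W ∈ Matrix.unitaryGroup (Fin d) ℂ) (j : Fin d) : ∑ i, overlap V W i j = 1 := by
  have h : (V.conjTranspose * W).conjTranspose * (V.conjTranspose * W) = 1 := by
    rw [Matrix.conjTranspose_mul, Matrix.conjTranspose_conjTranspose, Matrix.mul_assoc,
      ← Matrix.mul_assoc V, mul_conjTranspose_self_of_unitary hV, Matrix.one_mul,
      conjTranspose_mul_self_of_unitary hW]
  have h' := congrFun (congrFun h j) j
  rw [Matrix.mul_apply, Matrix.one_apply_eq] at h'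
  simp only [Matrix.conjTranspose_apply, RCLike.star_def, ← Complex.normSq_eq_conj_mul_self] at h'
  exact_mod_cast h'

/-- Cyclicity of the trace brings everything to `M = V* W`. For unitary `V`, `W` the weights `|M i
j|²` have row and column sums one, so a trace inequality follows from its scalar version at each
pair of eigenvalues. -/
theorem frob_conjDiag_conjDiag (V W : CMat d) (a b : Fin d → ℝ) :
    frob (conjDiag V a) (conjDiag W b) = ∑ i, ∑ j, overlap V W i j * (a i * b j) := by
  have h : (conjDiag V a * conjDiag W b).trace
      = (Matrix.diagonal (fun i => (a i : ℂ)) * (V.conjTranspose * W)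
        * Matrix.diagonal (fun i => (b i : ℂ)) * (V.conjTranspose * W).conjTranspose).trace := by
    rw [Matrix.conjTranspose_mul, Matrix.conjTranspose_conjTranspose]
    rw [conjDiag, conjDiag, Matrix.mul_assoc, Matrix.mul_assoc, Matrix.trace_mul_comm]
    simp only [Matrix.mul_assoc]
  rw [frob, h, Matrix.trace, Complex.re_sum]
  refine Finset.sum_congr rfl fun i _ => ?_
  rw [Matrix.diag_apply, Matrix.mul_apply, Complex.re_sum]
  refine Finset.sum_congr rfl fun j _ => ?_
  rw [Matrix.mul_diagonal, Matrix.diagonal_mul, Matrix.conjTranspose_apply, overlap]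
  have : (a i : ℂ) * (V.conjTranspose * W) i j * (b j : ℂ) * star ((V.conjTranspose * W) i j)
      = ((Complex.normSq ((V.conjTranspose * W) i j) * (a i * b j) : ℝ) : ℂ) := by
    push_cast
    rw [← Complex.mul_conj, RCLike.star_def]
    ring
  rw [this, Complex.ofReal_re]

end ConjDiag

/-! ### The trace inner product -/

section Frob

variable {d : ℕ}

theorem frob_add_left (A B C : CMat d) : frob (A + B) C = frob A C + frob B C := by
  simp [frob, add_mul]

theorem frob_add_right (A B C : CMat d) : frob A (B + C) = frob A B + frob A C := by
  simp [frob, mul_add]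

theorem frob_sub_left (A B C : CMat d) : frob (A - B) C = frob A C - frob B C := by
  simp [frob, sub_mul]

theorem frob_sub_right (A B C : CMat d) : frob A (B - C) = frob A B - frob A C := by
  simp [frob, mul_sub]

theorem frob_smul_left (r : ℝ) (A B : CMat d) : frob (r • A) B = r * frob A B := by
  simp [frob]

theorem frob_smul_right (r : ℝ) (A B : CMat d) : frob A (r • B) = r * frob A B := by
  simp [frob]

theorem frob_neg_left (A B : CMat d) : frob (-A) B = -frob A B := by
  simp [frob]

theorem frob_zero_right (A : CMat d) : frob A 0 = 0 := by simp [frob]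

theorem frob_comm (A B : CMat d) : frob A B = frob B A := by
  rw [frob, frob, Matrix.trace_mul_comm]

theorem frob_one_left (A : CMat d) : frob 1 A = A.trace.re := by simp [frob]

theorem frob_one_right (A : CMat d) : frob A 1 = A.trace.re := by simp [frob]

theorem frob_nonneg {A B : CMat d} (hA : A.PosSemidef) (hB : B.PosSemidef) : 0 ≤ frob A B := by
  obtain ⟨V, hV, a, rfl⟩ := exists_eq_conjDiag hA.1
  obtain ⟨W, hW, b, rfl⟩ := exists_eq_conjDiag hB.1
  rw [posSemidef_conjDiag_iff hV] at hA
  rw [posSemidef_conjDiag_iff hW] at hB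
  rw [frob_conjDiag_conjDiag]
  exact Finset.sum_nonneg fun i _ => Finset.sum_nonneg fun j _ =>
    mul_nonneg (overlap_nonneg _ _ _ _) (mul_nonneg (hA i) (hB j))

theorem posSemidef_smul {A : CMat d} (hA : A.PosSemidef) {r : ℝ} (hr : 0 ≤ r) :
    (r • A).PosSemidef := by
  obtain ⟨V, hV, a, rfl⟩ := exists_eq_conjDiag hA.1
  rw [posSemidef_conjDiag_iff hV] at hA
  rw [conjDiag_smul, posSemidef_conjDiag_iff hV]
  exact fun i => mul_nonneg hr (hA i)

theorem isHermitian_smul {A : CMat d} (hA : A.IsHermitian) (r : ℝ) : (r • A).IsHermitian := by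
  obtain ⟨V, _, a, rfl⟩ := exists_eq_conjDiag hA
  rw [conjDiag_smul]
  exact conjDiag_isHermitian _ _

theorem posSemidef_smul_one {r : ℝ} (hr : 0 ≤ r) : (r • (1 : CMat d)).PosSemidef :=
  posSemidef_smul Matrix.PosSemidef.one hr

end Frob

/-! ### Klein-type trace inequalities -/

/-- The trace of a spectral function, as a sum over the pairs of eigenvectors of two matrices. -/
theorem sum_eq_sum_overlap_left {d : ℕ} {V W : CMat d}
    (hV : V ∈ Matrix.unitaryGroup (Fin d) ℂ) (hW : W ∈ Matrix.unitaryGroup (Fin d) ℂ)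
    (a : Fin d → ℝ) : ∑ i, a i = ∑ i, ∑ j, overlap V W i j * a i := by
  refine Finset.sum_congr rfl fun i _ => ?_
  rw [← Finset.sum_mul, sum_overlap_right hV hW, one_mul]

theorem sum_eq_sum_overlap_right {d : ℕ} {V W : CMat d}
    (hV : V ∈ Matrix.unitaryGroup (Fin d) ℂ) (hW : W ∈ Matrix.unitaryGroup (Fin d) ℂ)
    (b : Fin d → ℝ) : ∑ j, b j = ∑ i, ∑ j, overlap V W i j * b j := by
  rw [Finset.sum_comm]
  refine Finset.sum_congr rfl fun j _ => ?_
  rw [← Finset.sum_mul, sum_overlap_left hV hW, one_mul]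

/-- Klein's inequality for a function with supporting slopes `f'`. -/
theorem klein_inequality {d : ℕ} {f f' : ℝ → ℝ} (hf : ∀ a b, f a + f' a * (b - a) ≤ f b)
    {A B : CMat d} (hA : A.IsHermitian) (hB : B.IsHermitian) :
    (cfc f A).trace.re + frob (cfc f' A) (B - A) ≤ (cfc f B).trace.re := by
  obtain ⟨V, hV, a, rfl⟩ := exists_eq_conjDiag hA
  obtain ⟨W, hW, b, rfl⟩ := exists_eq_conjDiag hB
  rw [cfc_conjDiag hV, cfc_conjDiag hV, cfc_conjDiag hW, trace_conjDiag hV, trace_conjDiag hW,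
    frob_sub_right, frob_conjDiag_conjDiag, frob, conjDiag_mul hV, trace_conjDiag hV]
  simp only [Complex.ofReal_re]
  rw [sum_eq_sum_overlap_left hV hW (fun i => f (a i)),
    sum_eq_sum_overlap_right hV hW (fun i => f (b i)),
    sum_eq_sum_overlap_left hV hW (fun i => f' (a i) * a i)]
  simp only [← Finset.sum_sub_distrib, ← Finset.sum_add_distrib]
  refine Finset.sum_le_sum fun i _ => Finset.sum_le_sum fun j _ => ?_
  have := mul_le_mul_of_nonneg_left (hf (a i) (b j)) (overlap_nonneg V W i j)
  linarith

/-- Traces of monotone convex functions are monotone in the Loewner order. -/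
theorem trace_cfc_mono {d : ℕ} {f f' : ℝ → ℝ} (hf : ∀ a b, f a + f' a * (b - a) ≤ f b)
    (hf' : ∀ a, 0 ≤ f' a) {A B : CMat d} (hA : A.IsHermitian) (hB : B.IsHermitian)
    (hAB : (B - A).PosSemidef) : (cfc f A).trace.re ≤ (cfc f B).trace.re := by
  have h : (cfc f' A).PosSemidef := by
    obtain ⟨V, hV, a, rfl⟩ := exists_eq_conjDiag hA
    rw [cfc_conjDiag hV, posSemidef_conjDiag_iff hV]
    exact fun i => hf' _
  linarith [klein_inequality hf hA hB, frob_nonneg h hAB]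

/-! ### A trace inequality for the matrix exponential -/

/-- For a convex function the trapezoid rule overestimates the integral, here that of `exp` over
`[0, u]`. -/
theorem exp_sub_one_le_trapezoid {u : ℝ} (hu : 0 ≤ u) :
    Real.exp u - 1 ≤ u * (Real.exp u + 1) / 2 := by
  let h : ℝ → ℝ := fun u => u * (Real.exp u + 1) / 2 - (Real.exp u - 1)
  have hd : ∀ x, HasDerivAt h ((1 - Real.exp x + x * Real.exp x) / 2) x := by
    intro x
    have h1 := (((hasDerivAt_id x).mul ((Real.hasDerivAt_exp x).add_const 1)).div_const 2).sub
      ((Real.hasDerivAt_exp x).sub_const 1)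
    refine h1.congr_deriv ?_
    simp only [id]
    ring
  have hm : MonotoneOn h (Set.Ici 0) := by
    apply monotoneOn_of_deriv_nonneg (convex_Ici 0)
      (fun x _ => (hd x).continuousAt.continuousWithinAt)
      (fun x _ => (hd x).differentiableAt.differentiableWithinAt)
    intro x _
    rw [(hd x).deriv]
    have h1 : 1 - x ≤ Real.exp (-x) := by linarith [Real.add_one_le_exp (-x)]
    have h2 : (1 - x) * Real.exp x ≤ 1 := by
      calc (1 - x) * Real.exp x ≤ Real.exp (-x) * Real.exp x :=
            mul_le_mul_of_nonneg_right h1 (Real.exp_pos x).le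
        _ = 1 := by rw [← Real.exp_add]; simp
    linarith
  have h0 := hm (Set.mem_Ici.2 le_rfl) (Set.mem_Ici.2 hu) hu
  simp only [h, Real.exp_zero] at h0
  linarith

theorem sub_mul_exp_sub_exp_le (x y : ℝ) :
    (x - y) * (Real.exp x - Real.exp y) ≤ (x - y) ^ 2 * (Real.exp x + Real.exp y) / 2 := by
  wlog hxy : y ≤ x generalizing x y
  · have := this y x (le_of_not_ge hxy)
    linarith [this]
  have h := exp_sub_one_le_trapezoid (sub_nonneg.2 hxy)
  have he : Real.exp x = Real.exp y * Real.exp (x - y) := by rw [← Real.exp_add]; ring_nf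
  have h2 := mul_le_mul_of_nonneg_left h
    (mul_nonneg (sub_nonneg.2 hxy) (Real.exp_pos y).le)
  rw [he]
  linarith

/-- Needed for differentiability in the matrix, which the power series gives and the functional
calculus does not show. -/
theorem cfc_exp_eq_exp {d : ℕ} {A : CMat d} (hA : A.IsHermitian) :
    cfc Real.exp A = NormedSpace.exp A := by
  obtain ⟨V, hV, a, rfl⟩ := exists_eq_conjDiag hA
  have hinv : V⁻¹ = V.conjTranspose :=
    Matrix.inv_eq_left_inv (conjTranspose_mul_self_of_unitary hV)
  have hu : IsUnit V := ⟨⟨V, V.conjTranspose, mul_conjTranspose_self_of_unitary hV,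
    conjTranspose_mul_self_of_unitary hV⟩, rfl⟩
  rw [cfc_conjDiag hV, conjDiag, conjDiag, ← hinv, Matrix.exp_conj _ _ hu, Matrix.exp_diagonal]
  congr 3
  funext i
  rw [Pi.coe_exp]
  simp [← Complex.exp_eq_exp_ℂ]

/-- The overlap-weighted sum of `sub_mul_exp_sub_exp_le`. It stands in for a second-derivative bound
on `tr exp`, without any formula for the derivative of the matrix exponential. -/
theorem frob_sub_exp_sub_exp_le {d : ℕ} {A B : CMat d} (hA : A.IsHermitian) (hB : B.IsHermitian) :
    frob (B - A) (cfc Real.exp B - cfc Real.exp A) ≤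
      (frob (cfc Real.exp A) ((B - A) * (B - A)) + frob (cfc Real.exp B) ((B - A) * (B - A))) / 2
      := by
  obtain ⟨V, hV, a, rfl⟩ := exists_eq_conjDiag hA
  obtain ⟨W, hW, b, rfl⟩ := exists_eq_conjDiag hB
  rw [cfc_conjDiag hV, cfc_conjDiag hW]
  -- In the expansion of the square, every product of factors diagonal in the basis `V` collapses,
  -- leaving traces of a `V`-diagonal times a `W`-diagonal matrix. The weight diagonal in `W` is
  -- handled below by exchanging the bases.
  have key : ∀ {V W : CMat d}, V ∈ Matrix.unitaryGroup (Fin d) ℂ →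
      W ∈ Matrix.unitaryGroup (Fin d) ℂ → ∀ a b e : Fin d → ℝ,
      frob (conjDiag V e) ((conjDiag W b - conjDiag V a) * (conjDiag W b - conjDiag V a))
        = ∑ i, ∑ j, overlap V W i j * (e i * (b j - a i) ^ 2) := by
    intro V W hV hW a b e
    have h : (conjDiag V e * ((conjDiag W b - conjDiag V a) * (conjDiag W b - conjDiag V a))).trace
        = (conjDiag V e * (conjDiag W b * conjDiag W b)).trace
          - (conjDiag V e * conjDiag V a * conjDiag W b).trace
          - (conjDiag V a * conjDiag V e * conjDiag W b).trace
          + (conjDiag V e * (conjDiag V a * conjDiag V a)).trace := by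
      have h1 : (conjDiag V a * conjDiag V e * conjDiag W b).trace
          = (conjDiag V e * (conjDiag W b * conjDiag V a)).trace := by
        rw [Matrix.mul_assoc, Matrix.trace_mul_comm, Matrix.mul_assoc]
      rw [h1, ← Matrix.trace_sub, ← Matrix.trace_sub, ← Matrix.trace_add]
      congr 1
      noncomm_ring
    have h2 : frob (conjDiag V e)
          ((conjDiag W b - conjDiag V a) * (conjDiag W b - conjDiag V a))
        = frob (conjDiag V e) (conjDiag W b * conjDiag W b)
          - frob (conjDiag V e * conjDiag V a) (conjDiag W b)
          - frob (conjDiag V a * conjDiag V e) (conjDiag W b)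
          + (conjDiag V e * (conjDiag V a * conjDiag V a)).trace.re := by
      simp only [frob, h, Complex.sub_re, Complex.add_re]
    rw [h2, conjDiag_mul hW, conjDiag_mul hV, conjDiag_mul hV, conjDiag_mul hV, conjDiag_mul hV,
      trace_conjDiag hV, frob_conjDiag_conjDiag, frob_conjDiag_conjDiag, frob_conjDiag_conjDiag,
      Complex.ofReal_re,
      sum_eq_sum_overlap_left hV hW (fun i => e i * (a i * a i))]
    simp only [← Finset.sum_sub_distrib, ← Finset.sum_add_distrib]
    refine Finset.sum_congr rfl fun i _ => Finset.sum_congr rfl fun j _ => ?_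
    ring
  have hVW : frob (conjDiag W (fun i => Real.exp (b i)))
      ((conjDiag W b - conjDiag V a) * (conjDiag W b - conjDiag V a))
      = ∑ i, ∑ j, overlap V W i j * (Real.exp (b j) * (b j - a i) ^ 2) := by
    have h1 : (conjDiag W b - conjDiag V a) * (conjDiag W b - conjDiag V a)
        = (conjDiag V a - conjDiag W b) * (conjDiag V a - conjDiag W b) := by noncomm_ring
    rw [h1, key hW hV, Finset.sum_comm]
    refine Finset.sum_congr rfl fun i _ => Finset.sum_congr rfl fun j _ => ?_
    have : overlap W V j i = overlap V W i j := by
      have h : W.conjTranspose * V = (V.conjTranspose * W).conjTranspose := by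
        rw [Matrix.conjTranspose_mul, Matrix.conjTranspose_conjTranspose]
      rw [overlap, overlap, h, Matrix.conjTranspose_apply, RCLike.star_def, Complex.normSq_conj]
    rw [this]
    ring
  rw [key hV hW, hVW]
  rw [frob_sub_left, frob_sub_right, frob_sub_right, frob_comm (conjDiag W b) (conjDiag V _)]
  have hWW : frob (conjDiag W b) (conjDiag W fun i => Real.exp (b i))
      = ∑ i, ∑ j, overlap V W i j * (b j * Real.exp (b j)) := by
    rw [frob, conjDiag_mul hW, trace_conjDiag hW, Complex.ofReal_re,
      sum_eq_sum_overlap_right hV hW]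
  have hVV : frob (conjDiag V a) (conjDiag V fun i => Real.exp (a i))
      = ∑ i, ∑ j, overlap V W i j * (a i * Real.exp (a i)) := by
    rw [frob, conjDiag_mul hV, trace_conjDiag hV, Complex.ofReal_re,
      sum_eq_sum_overlap_left hV hW]
  rw [hWW, hVV, frob_conjDiag_conjDiag, frob_conjDiag_conjDiag, ← Finset.sum_add_distrib,
    Finset.sum_div]
  simp only [← Finset.sum_sub_distrib, ← Finset.sum_add_distrib, Finset.sum_div]
  refine Finset.sum_le_sum fun i _ => Finset.sum_le_sum fun j _ => ?_
  have := mul_le_mul_of_nonneg_left (sub_mul_exp_sub_exp_le (b j) (a i)) (overlap_nonneg V W i j)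
  linarith

section Derivative

attribute [local instance] Matrix.linftyOpNormedRing Matrix.linftyOpNormedAlgebra

theorem differentiable_exp_line {d : ℕ} (A R : CMat d) :
    Differentiable ℝ (fun s : ℝ => NormedSpace.exp (A + s • R)) := by
  have h : Differentiable ℝ (NormedSpace.exp : CMat d → CMat d) := fun x =>
    ((NormedSpace.exp_analytic (𝕂 := ℝ) x)).differentiableAt
  exact h.comp ((differentiable_const A).add (differentiable_id.smul_const R))

theorem differentiable_frob_exp_line {d : ℕ} (A R Q : CMat d) :
    Differentiable ℝ (fun s : ℝ => frob Q (NormedSpace.exp (A + s • R))) := by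
  let φ : CMat d →ₗ[ℝ] ℝ :=
    { toFun := fun X => frob Q X
      map_add' := fun X Y => frob_add_right Q X Y
      map_smul' := fun r X => frob_smul_right r Q X }
  exact (LinearMap.toContinuousLinearMap φ).differentiable.comp (differentiable_exp_line A R)

end Derivative

theorem nonneg_of_hasDerivAt_of_nonneg_right {φ : ℝ → ℝ} {c : ℝ} (h : HasDerivAt φ c 0)
    (h0 : φ 0 = 0) (hn : ∀ s, 0 < s → 0 ≤ φ s) : 0 ≤ c := by
  have h1 := (hasDerivWithinAt_iff_tendsto_slope' (s := Set.Ioi (0 : ℝ)) (by simp)).1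
    h.hasDerivWithinAt
  refine ge_of_tendsto h1 ?_
  filter_upwards [self_mem_nhdsWithin] with s hs
  rw [slope_def_field, h0]
  have : 0 < s := hs
  have := hn s this
  simp only [sub_zero]
  positivity

/-- Along a line whose direction is a contraction, `tr exp` is bounded by the solution of `f'' = f`
with the same initial values. -/
theorem trace_exp_add_smul_le {d : ℕ} {A R : CMat d} (hA : A.IsHermitian) (hR : R.IsHermitian)
    (hR1 : (1 - R * R).PosSemidef) (s : ℝ) :
    (cfc Real.exp (A + s • R)).trace.re ≤
      Real.cosh s * (cfc Real.exp A).trace.re + Real.sinh s * frob R (cfc Real.exp A) := by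
  -- Replacing `(R, s)` by `(-R, -s)` changes neither side, as `cosh` is even and `sinh` is odd.
  wlog hs : 0 ≤ s generalizing s R
  · have h := this (R := -R) hR.neg (by simpa using hR1) (-s) (by linarith)
    simpa [frob_neg_left] using h
  have hH : ∀ s : ℝ, (A + s • R).IsHermitian := fun s => hA.add (isHermitian_smul hR s)
  set f : ℝ → ℝ := fun s => frob 1 (NormedSpace.exp (A + s • R)) with hf
  set g : ℝ → ℝ := fun s => frob R (NormedSpace.exp (A + s • R)) with hg
  have hfd : Differentiable ℝ f := differentiable_frob_exp_line A R 1
  have hgd : Differentiable ℝ g := differentiable_frob_exp_line A R R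
  have hfe : ∀ s, f s = (cfc Real.exp (A + s • R)).trace.re := fun s => by
    rw [cfc_exp_eq_exp (hH s), ← frob_one_left]
  have hge : ∀ s, g s = frob R (cfc Real.exp (A + s • R)) := fun s => by
    rw [cfc_exp_eq_exp (hH s)]
  have hsupp : ∀ s u, f s + (u - s) * g s ≤ f u := by
    intro s u
    have h := klein_inequality (f := Real.exp) (f' := Real.exp)
      (fun a b => by
        have := mul_le_mul_of_nonneg_left (Real.add_one_le_exp (b - a)) (Real.exp_pos a).le
        rw [← Real.exp_add] at this
        ring_nf at this ⊢
        linarith) (hH s) (hH u)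
    have h2 : (A + u • R) - (A + s • R) = (u - s) • R := by rw [sub_smul]; abel
    rw [h2, frob_smul_right, frob_comm, ← hfe, ← hfe, ← hge] at h
    exact h
  -- Klein's inequality gives a supporting line of slope `g s` at `s`; a differentiable function has
  -- no other supporting slope.
  have hf' : ∀ s, deriv f s = g s := by
    intro s
    have hd : HasDerivAt (fun u => f u - (u - s) * g s) (deriv f s - 1 * g s) s :=
      (hfd s).hasDerivAt.sub (((hasDerivAt_id s).sub_const s).mul_const (g s))
    have hmin : IsLocalMin (fun u => f u - (u - s) * g s) s :=
      Filter.Eventually.of_forall fun u => by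
        have := hsupp s u
        simp only [sub_self, zero_mul, sub_zero]
        linarith
    have := hmin.hasDerivAt_eq_zero hd
    linarith
  -- The trapezoid bound controls the increments of `g` by `h (f s + f (s + h)) / 2`, once `R * R ≤
  -- 1` removes the factor `R * R`; then `h` tends to `0` from the right.
  have hg' : ∀ s, deriv g s ≤ f s := by
    intro s
    have hRR : ∀ u, frob (cfc Real.exp (A + u • R)) (R * R) ≤ f u := by
      intro u
      have hp : (cfc Real.exp (A + u • R)).PosSemidef := by
        obtain ⟨V, hV, a, hVa⟩ := exists_eq_conjDiag (hH u)
        rw [hVa, cfc_conjDiag hV, posSemidef_conjDiag_iff hV]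
        exact fun i => (Real.exp_pos _).le
      have := frob_nonneg hp hR1
      rw [frob_sub_right, frob_one_right, ← hfe] at this
      linarith
    have hinc : ∀ h, 0 < h → g (s + h) - g s ≤ h * ((f s + f (s + h)) / 2) := by
      intro h hh
      have h1 := frob_sub_exp_sub_exp_le (hH s) (hH (s + h))
      have h2 : (A + (s + h) • R) - (A + s • R) = h • R := by rw [add_smul]; abel
      have h3 : (h • R) * (h • R) = (h * h) • (R * R) := by
        rw [smul_mul_smul_comm]
      rw [h2, h3, frob_smul_left, frob_sub_right, ← hge, ← hge, frob_smul_right,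
        frob_smul_right] at h1
      have h4 := hRR s
      have h5 := hRR (s + h)
      have h6 : h * (g (s + h) - g s) ≤ h * (h * ((f s + f (s + h)) / 2)) := by
        have := mul_le_mul_of_nonneg_left (add_le_add h4 h5) (mul_pos hh hh).le
        linarith
      exact le_of_mul_le_mul_left h6 hh
    have hds : HasDerivAt (fun h : ℝ => s + h) 1 0 := (hasDerivAt_id (0 : ℝ)).const_add s
    have hd1 : HasDerivAt (fun h => f (s + h)) (deriv f s) 0 := by
      exact HasDerivAt.comp_const_add s 0 (f := f) (by rw [add_zero]; exact (hfd s).hasDerivAt)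
    have hd2 : HasDerivAt (fun h => g (s + h)) (deriv g s) 0 := by
      exact HasDerivAt.comp_const_add s 0 (f := g) (by rw [add_zero]; exact (hgd s).hasDerivAt)
    have hd3 : HasDerivAt (fun h => h * ((f s + f (s + h)) / 2) - (g (s + h) - g s))
        (f s - deriv g s) 0 := by
      have := ((hasDerivAt_id (0 : ℝ)).mul ((hd1.const_add (f s)).div_const 2)).sub
        (hd2.sub_const (g s))
      refine this.congr_deriv ?_
      simp
    have := nonneg_of_hasDerivAt_of_nonneg_right hd3 (by simp)
      (fun h hh => by linarith [hinc h hh])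
    linarith
  have hdf : ∀ s, HasDerivAt f (g s) s := fun s => hf' s ▸ (hfd s).hasDerivAt
  -- The inequality `f'' ≤ f` is integrated in two first-order steps: `(f + g)' ≤ f + g` here, and
  -- then `(exp · f)' = exp · (f + g)`, which is at most `exp(2 s) (f 0 + g 0)`.
  have hanti : AntitoneOn (fun s => Real.exp (-s) * (f s + g s)) (Set.Ici 0) := by
    have hd : ∀ s, HasDerivAt (fun s => Real.exp (-s) * (f s + g s))
        (-Real.exp (-s) * (f s + g s) + Real.exp (-s) * (g s + deriv g s)) s := by
      intro s
      have he : HasDerivAt (fun s => Real.exp (-s)) (-Real.exp (-s)) s := by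
        simpa using (hasDerivAt_neg s).exp
      exact he.mul ((hdf s).add (hgd s).hasDerivAt)
    apply antitoneOn_of_deriv_nonpos (convex_Ici 0)
      (fun x _ => (hd x).continuousAt.continuousWithinAt)
      (fun x _ => (hd x).differentiableAt.differentiableWithinAt)
    intro x _
    rw [(hd x).deriv]
    have := mul_le_mul_of_nonneg_left (hg' x) (Real.exp_pos (-x)).le
    linarith
  have hle : ∀ s, 0 ≤ s → f s + g s ≤ Real.exp s * (f 0 + g 0) := by
    intro s hs
    have h := hanti (Set.mem_Ici.2 le_rfl) (Set.mem_Ici.2 hs) hs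
    simp only [neg_zero, Real.exp_zero, one_mul] at h
    have h2 := mul_le_mul_of_nonneg_left h (Real.exp_pos s).le
    rwa [← mul_assoc, ← Real.exp_add, add_neg_cancel, Real.exp_zero, one_mul] at h2
  have hanti2 : AntitoneOn
      (fun s => Real.exp s * f s - Real.exp s * Real.exp s * ((f 0 + g 0) / 2)) (Set.Ici 0) := by
    have hd : ∀ s, HasDerivAt
        (fun s => Real.exp s * f s - Real.exp s * Real.exp s * ((f 0 + g 0) / 2))
        ((Real.exp s * f s + Real.exp s * g s)
          - (Real.exp s * Real.exp s + Real.exp s * Real.exp s) * ((f 0 + g 0) / 2)) s :=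
      fun s => ((Real.hasDerivAt_exp s).mul (hdf s)).sub
        (((Real.hasDerivAt_exp s).mul (Real.hasDerivAt_exp s)).mul_const _)
    apply antitoneOn_of_deriv_nonpos (convex_Ici 0)
      (fun x _ => (hd x).continuousAt.continuousWithinAt)
      (fun x _ => (hd x).differentiableAt.differentiableWithinAt)
    intro x hx
    rw [interior_Ici, Set.mem_Ioi] at hx
    rw [(hd x).deriv]
    have := mul_le_mul_of_nonneg_left (hle x hx.le) (Real.exp_pos x).le
    linarith
  have h := hanti2 (Set.mem_Ici.2 le_rfl) (Set.mem_Ici.2 hs) hs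
  simp only [Real.exp_zero, one_mul] at h
  have h2 := mul_le_mul_of_nonneg_left h (Real.exp_pos (-s)).le
  have h3 : Real.exp (-s) * Real.exp s = 1 := by rw [← Real.exp_add]; simp
  have h4 : f s ≤ Real.cosh s * f 0 + Real.sinh s * g 0 := by
    rw [Real.cosh_eq, Real.sinh_eq]
    have e1 : Real.exp (-s) * (Real.exp s * f s - Real.exp s * Real.exp s * ((f 0 + g 0) / 2))
        = (Real.exp (-s) * Real.exp s) * f s
          - (Real.exp (-s) * Real.exp s) * (Real.exp s * ((f 0 + g 0) / 2)) := by ring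
    rw [e1, h3] at h2
    linarith
  have e0 : A + (0 : ℝ) • R = A := by simp
  rw [hfe, hfe, hge, e0] at h4
  exact h4

/-! ### The erfi potential -/

theorem le_of_hasDerivAt_le {f g f' g' : ℝ → ℝ} {a x : ℝ} (hf : ∀ u, HasDerivAt f (f' u) u)
    (hg : ∀ u, HasDerivAt g (g' u) u) (h0 : f a ≤ g a) (hax : a ≤ x)
    (h : ∀ u, a < u → u < x → f' u ≤ g' u) : f x ≤ g x := by
  have hd : ∀ u, HasDerivAt (fun u => g u - f u) (g' u - f' u) u := fun u => (hg u).sub (hf u)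
  have hm : MonotoneOn (fun u => g u - f u) (Set.Icc a x) := by
    apply monotoneOn_of_deriv_nonneg (convex_Icc a x)
      (fun x _ => (hd x).continuousAt.continuousWithinAt)
      (fun x _ => (hd x).differentiableAt.differentiableWithinAt)
    intro u hu
    rw [interior_Icc, Set.mem_Ioo] at hu
    rw [(hd u).deriv]
    linarith [h u hu.1 hu.2]
  have := hm (Set.left_mem_Icc.2 hax) (Set.right_mem_Icc.2 hax) hax
  simp only at this
  linarith

theorem hasDerivAt_erfiInt (y : ℝ) : HasDerivAt erfiInt (Real.exp (y ^ 2)) y := by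
  have hc : Continuous fun u : ℝ => Real.exp (u ^ 2) := by fun_prop
  exact intervalIntegral.integral_hasDerivAt_right (hc.intervalIntegrable _ _)
    (hc.stronglyMeasurableAtFilter _ _) hc.continuousAt

theorem erfiInt_zero : erfiInt 0 = 0 := by simp [erfiInt]

theorem erfiInt_neg (y : ℝ) : erfiInt (-y) = -erfiInt y := by
  have h := intervalIntegral.integral_comp_neg (a := 0) (b := y) fun u : ℝ => Real.exp (u ^ 2)
  simp only [neg_sq, neg_zero] at h
  rw [erfiInt, erfiInt, intervalIntegral.integral_symm, h]

theorem erfiInt_nonneg {y : ℝ} (hy : 0 ≤ y) : 0 ≤ erfiInt y :=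
  intervalIntegral.integral_nonneg hy fun _ _ => (Real.exp_pos _).le

/-- The profile `2 y ∫₀^y exp(u²) du - exp(y²)` of the erfi potential. -/
def erfiProfile (y : ℝ) : ℝ := 2 * y * erfiInt y - Real.exp (y ^ 2)

theorem hasDerivAt_erfiProfile (y : ℝ) : HasDerivAt erfiProfile (2 * erfiInt y) y := by
  have h1 := (((hasDerivAt_id y).const_mul 2).mul (hasDerivAt_erfiInt y)).sub
    ((hasDerivAt_id y).pow 2).exp
  refine h1.congr_deriv ?_
  simp
  ring

theorem erfiProfile_zero : erfiProfile 0 = -1 := by simp [erfiProfile]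

theorem erfiProfile_neg (y : ℝ) : erfiProfile (-y) = erfiProfile y := by
  simp [erfiProfile, erfiInt_neg]

/-- Integration by parts: the double integral becomes a closed form in `exp` and `erfiInt`, the form
used both by the analysis and by the program. -/
theorem integral_erfiInt (y : ℝ) : 2 * (∫ u in (0 : ℝ)..y, erfiInt u) - 1 = erfiProfile y := by
  have hc : Continuous fun u => 2 * erfiInt u :=
    (continuous_iff_continuousAt.2 fun u => (hasDerivAt_erfiInt u).continuousAt).const_mul 2
  have h := intervalIntegral.integral_eq_sub_of_hasDerivAt (a := 0) (b := y)
    (fun u _ => hasDerivAt_erfiProfile u) (hc.intervalIntegrable _ _)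
  rw [intervalIntegral.integral_const_mul, erfiProfile_zero] at h
  linarith

theorem erfiPotential_eq (d : ℕ) (ε : ℝ) (t : ℕ) (s : ℝ) :
    erfiPotential d ε t s = ε * √(t : ℝ) / d * erfiProfile (s / √(2 * ε ^ 2 * t)) := by
  rw [erfiPotential, integral_erfiInt]

theorem erfiProfile_add_le (a b : ℝ) :
    erfiProfile a + 2 * erfiInt a * (b - a) ≤ erfiProfile b := by
  have hmono : Monotone erfiInt := by
    apply monotone_of_deriv_nonneg fun u => (hasDerivAt_erfiInt u).differentiableAt
    intro u
    rw [(hasDerivAt_erfiInt u).deriv]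
    exact (Real.exp_pos _).le
  have hc : ConvexOn ℝ Set.univ erfiProfile := by
    apply Monotone.convexOn_univ_of_deriv fun u => (hasDerivAt_erfiProfile u).differentiableAt
    have : deriv erfiProfile = fun u => 2 * erfiInt u :=
      funext fun u => (hasDerivAt_erfiProfile u).deriv
    rw [this]
    exact hmono.const_mul (by norm_num)
  rcases lt_trichotomy a b with h | h | h
  · have := hc.le_slope_of_hasDerivAt (Set.mem_univ a) (Set.mem_univ b) h (hasDerivAt_erfiProfile a)
    rw [slope_def_field, le_div_iff₀ (by linarith)] at this
    linarith
  · simp [h]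
  · have := hc.slope_le_of_hasDerivAt (Set.mem_univ b) (Set.mem_univ a) h (hasDerivAt_erfiProfile a)
    rw [slope_def_field, div_le_iff₀ (by linarith)] at this
    linarith

theorem neg_one_le_erfiProfile (y : ℝ) : -1 ≤ erfiProfile y := by
  have := erfiProfile_add_le 0 y
  simpa [erfiInt_zero, erfiProfile_zero] using this

theorem erfiInt_le {z : ℝ} (h0 : 0 ≤ z) (h1 : z ≤ 1) : erfiInt z ≤ z + z ^ 3 := by
  refine le_of_hasDerivAt_le (a := 0) (g := fun z => z + z ^ 3)
    (g' := fun u => 1 + 3 * u ^ 2) hasDerivAt_erfiInt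
    (fun u => ?_) (by simp [erfiInt_zero]) h0 fun u hu hu1 => ?_
  · refine ((hasDerivAt_id u).add (hasDerivAt_pow 3 u)).congr_deriv ?_
    norm_num
  · have hv : u ^ 2 ≤ 1 := by nlinarith
    have := Real.abs_exp_sub_one_sub_id_le (x := u ^ 2) (by rwa [abs_of_nonneg (sq_nonneg u)])
    have := (abs_le.1 this).2
    nlinarith [sq_nonneg u]

theorem erfiProfile_le {z : ℝ} (h0 : 0 ≤ z) (h1 : z ≤ 1) :
    erfiProfile z ≤ -1 + z ^ 2 + z ^ 4 / 2 := by
  refine le_of_hasDerivAt_le (a := 0) (g := fun z => -1 + z ^ 2 + z ^ 4 / 2)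
    (g' := fun u => 2 * u + 2 * u ^ 3) hasDerivAt_erfiProfile
    (fun u => ?_) (by simp [erfiProfile_zero]) h0 fun u hu hu1 => ?_
  · refine (((hasDerivAt_pow 2 u).const_add (-1)).add
      ((hasDerivAt_pow 4 u).div_const 2)).congr_deriv ?_
    norm_num
    ring
  · have := erfiInt_le hu.le (hu1.le.trans h1)
    linarith

/-- The discrete Itô inequality at `s = 0`, where the constant `-1` in the potential matters. The
case `t = 1` serves the first round. -/
theorem sqrt_mul_erfiProfile_le {t : ℝ} (ht : 1 ≤ t) :
    √t * erfiProfile (1 / √(2 * t)) ≤ -√(t - 1) := by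
  set z := 1 / √(2 * t) with hz
  have hz0 : 0 ≤ z := by positivity
  have hz2 : z ^ 2 = 1 / (2 * t) := by
    rw [hz, div_pow, Real.sq_sqrt (by linarith)]; simp
  have hz1 : z ≤ 1 := by
    have : z ^ 2 ≤ 1 := by
      rw [hz2, div_le_one (by linarith)]; linarith
    nlinarith
  have h := erfiProfile_le hz0 hz1
  have hz4 : z ^ 4 = (1 / (2 * t)) ^ 2 := by rw [← hz2]; ring
  have hx0 : 0 < 1 / t := by positivity
  have hx1 : 1 / t ≤ 1 := by rw [div_le_one (by linarith)]; exact ht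
  have hzx : (1 / (2 * t)) = (1 / t) / 2 := by field_simp
  rw [hz2, hz4, hzx] at h
  -- With `x = 1 / t` the bracket is the second Taylor polynomial of `√(1 - x)`; its square exceeds
  -- `1 - x` by `x³/8 + x⁴/64`.
  have key : √(t - 1) ≤ √t * (1 - (1 / t) / 2 - ((1 / t) / 2) ^ 2 / 2) := by
    have hnn : 0 ≤ 1 - (1 / t) / 2 - ((1 / t) / 2) ^ 2 / 2 := by nlinarith
    apply Real.sqrt_le_iff.2
    refine ⟨mul_nonneg (Real.sqrt_nonneg _) hnn, ?_⟩
    rw [mul_pow, Real.sq_sqrt (by linarith)]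
    have e : t - 1 = t * (1 - 1 / t) := by field_simp
    rw [e]
    refine mul_le_mul_of_nonneg_left ?_ (by linarith)
    have h3 : 0 < (1 / t) ^ 3 := by positivity
    have h4 : 0 < (1 / t) ^ 4 := by positivity
    nlinarith
  have := mul_le_mul_of_nonneg_left h (Real.sqrt_nonneg t)
  linarith

/-- The Itô inequality for the second derivative in `s` of the potential. Averaging produces `cosh
(s / t)`, which is at most `exp(s² / (2 t²))`, and `exp(1 / t) ≤ t / (t - 1)` pays for the change of
the prefactor. -/
theorem average_exp_sq_le {t : ℝ} (ht : 1 < t) (s : ℝ) :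
    (Real.exp ((s + 1) ^ 2 / (2 * t)) + Real.exp ((s - 1) ^ 2 / (2 * t))) / 2 / √t ≤
      Real.exp (s ^ 2 / (2 * (t - 1))) / √(t - 1) := by
  have h1 : (Real.exp ((s + 1) ^ 2 / (2 * t)) + Real.exp ((s - 1) ^ 2 / (2 * t))) / 2
      = Real.exp (s ^ 2 / (2 * t) + 1 / (2 * t)) * Real.cosh (s / t) := by
    rw [Real.cosh_eq, mul_div_assoc', mul_add, ← Real.exp_add, ← Real.exp_add]
    congr 3 <;> (field_simp; ring)
  have h2 : Real.cosh (s / t) ≤ Real.exp ((s / t) ^ 2 / 2) := Real.cosh_le_exp_half_sq _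
  have h3 : Real.exp (1 / (2 * t)) / √t ≤ 1 / √(t - 1) := by
    rw [div_le_div_iff₀ (Real.sqrt_pos.2 (by linarith)) (Real.sqrt_pos.2 (by linarith)), one_mul]
    apply Real.le_sqrt_of_sq_le
    rw [mul_pow, Real.sq_sqrt (by linarith), ← Real.exp_nat_mul]
    have e : ((2 : ℕ) : ℝ) * (1 / (2 * t)) = 1 / t := by push_cast; field_simp
    rw [e]
    have h4 : 1 - 1 / t ≤ Real.exp (-(1 / t)) := by linarith [Real.add_one_le_exp (-(1 / t))]
    have h5 : Real.exp (1 / t) * (1 - 1 / t) ≤ 1 := by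
      calc _ ≤ Real.exp (1 / t) * Real.exp (-(1 / t)) :=
            mul_le_mul_of_nonneg_left h4 (Real.exp_pos _).le
        _ = 1 := by rw [← Real.exp_add]; simp
    have e2 : Real.exp (1 / t) * (t - 1) = t * (Real.exp (1 / t) * (1 - 1 / t)) := by
      field_simp
    rw [e2]
    nlinarith
  have h6 : s ^ 2 / (2 * t) + (s / t) ^ 2 / 2 ≤ s ^ 2 / (2 * (t - 1)) := by
    have : 0 < t - 1 := by linarith
    rw [← sub_nonneg]
    have e : s ^ 2 / (2 * (t - 1)) - (s ^ 2 / (2 * t) + (s / t) ^ 2 / 2)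
        = s ^ 2 / (2 * t ^ 2 * (t - 1)) := by
      field_simp
      ring
    rw [e]
    positivity
  rw [h1]
  calc Real.exp (s ^ 2 / (2 * t) + 1 / (2 * t)) * Real.cosh (s / t) / √t
      ≤ Real.exp (s ^ 2 / (2 * t) + 1 / (2 * t)) * Real.exp ((s / t) ^ 2 / 2) / √t := by gcongr
    _ = Real.exp (s ^ 2 / (2 * t) + (s / t) ^ 2 / 2) * (Real.exp (1 / (2 * t)) / √t) := by
        rw [mul_div_assoc', ← Real.exp_add, ← Real.exp_add]; congr 2; ring
    _ ≤ Real.exp (s ^ 2 / (2 * (t - 1))) * (1 / √(t - 1)) := by gcongr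
    _ = _ := by ring

theorem hasDerivAt_sqrt_mul_erfiProfile {t : ℝ} (ht : 0 < t) (c s : ℝ) :
    HasDerivAt (fun s => √t * erfiProfile ((s + c) / √(2 * t)))
      (√2 * erfiInt ((s + c) / √(2 * t))) s := by
  have h1 : HasDerivAt (fun s => (s + c) / √(2 * t)) (1 / √(2 * t)) s :=
    ((hasDerivAt_id s).add_const c).div_const _
  refine (((hasDerivAt_erfiProfile _).comp s h1).const_mul √t).congr_deriv ?_
  have hs : √t ≠ 0 := (Real.sqrt_pos.2 ht).ne'
  rw [Real.sqrt_mul (by norm_num) t]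
  have h2 : (√2 : ℝ) ^ 2 = 2 := Real.sq_sqrt (by norm_num)
  field_simp
  rw [h2]

theorem hasDerivAt_sqrt_two_mul_erfiInt {t : ℝ} (ht : 0 < t) (c s : ℝ) :
    HasDerivAt (fun s => √2 * erfiInt ((s + c) / √(2 * t)))
      (Real.exp ((s + c) ^ 2 / (2 * t)) / √t) s := by
  have h1 : HasDerivAt (fun s => (s + c) / √(2 * t)) (1 / √(2 * t)) s :=
    ((hasDerivAt_id s).add_const c).div_const _
  refine (((hasDerivAt_erfiInt _).comp s h1).const_mul √2).congr_deriv ?_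
  rw [div_pow, Real.sq_sqrt (by linarith), Real.sqrt_mul (by norm_num) t]
  have hs : √t ≠ 0 := (Real.sqrt_pos.2 ht).ne'
  have h2 : (√2 : ℝ) ≠ 0 := by positivity
  field_simp

/-- The discrete Itô inequality for the erfi potential. -/
theorem average_sqrt_mul_erfiProfile_le {t : ℝ} (ht : 1 < t) (s : ℝ) :
    (√t * erfiProfile ((s + 1) / √(2 * t)) + √t * erfiProfile ((s - 1) / √(2 * t))) / 2 ≤
      √(t - 1) * erfiProfile (s / √(2 * (t - 1))) := by
  have ht0 : 0 < t := by linarith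
  have ht1 : 0 < t - 1 := by linarith
  -- `D` is the gap to be shown nonnegative. It is convex because `D2` is nonnegative, and even, so
  -- it is smallest at `0`, where it is nonnegative by `sqrt_mul_erfiProfile_le`.
  let D : ℝ → ℝ := fun s => √(t - 1) * erfiProfile ((s + 0) / √(2 * (t - 1)))
    - (√t * erfiProfile ((s + 1) / √(2 * t)) + √t * erfiProfile ((s + -1) / √(2 * t))) / 2
  let D1 : ℝ → ℝ := fun s => √2 * erfiInt ((s + 0) / √(2 * (t - 1)))
    - (√2 * erfiInt ((s + 1) / √(2 * t)) + √2 * erfiInt ((s + -1) / √(2 * t))) / 2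
  let D2 : ℝ → ℝ := fun s => Real.exp ((s + 0) ^ 2 / (2 * (t - 1))) / √(t - 1)
    - (Real.exp ((s + 1) ^ 2 / (2 * t)) / √t + Real.exp ((s + -1) ^ 2 / (2 * t)) / √t) / 2
  have hD : ∀ s, HasDerivAt D (D1 s) s := fun s =>
    (hasDerivAt_sqrt_mul_erfiProfile ht1 0 s).sub
      (((hasDerivAt_sqrt_mul_erfiProfile ht0 1 s).add
        (hasDerivAt_sqrt_mul_erfiProfile ht0 (-1) s)).div_const 2)
  have hD1 : ∀ s, HasDerivAt D1 (D2 s) s := fun s =>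
    (hasDerivAt_sqrt_two_mul_erfiInt ht1 0 s).sub
      (((hasDerivAt_sqrt_two_mul_erfiInt ht0 1 s).add
        (hasDerivAt_sqrt_two_mul_erfiInt ht0 (-1) s)).div_const 2)
  have hD2 : ∀ s, 0 ≤ D2 s := by
    intro s
    have h := average_exp_sq_le ht s
    simp only [D2, add_zero, ← sub_eq_add_neg]
    rw [sub_nonneg]
    refine le_trans (le_of_eq ?_) h
    ring
  have hderiv : deriv D = D1 := funext fun s => (hD s).deriv
  have hconv : ConvexOn ℝ Set.univ D := by
    apply Monotone.convexOn_univ_of_deriv fun u => (hD u).differentiableAt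
    rw [hderiv]
    apply monotone_of_deriv_nonneg fun u => (hD1 u).differentiableAt
    intro u
    rw [(hD1 u).deriv]
    exact hD2 u
  have heven : D (-s) = D s := by
    simp only [D]
    have e1 : (-s + 0) / √(2 * (t - 1)) = -((s + 0) / √(2 * (t - 1))) := by ring
    have e2 : (-s + 1) / √(2 * t) = -((s + -1) / √(2 * t)) := by ring
    have e3 : (-s + -1) / √(2 * t) = -((s + 1) / √(2 * t)) := by ring
    rw [e1, e2, e3, erfiProfile_neg, erfiProfile_neg, erfiProfile_neg]
    ring
  have h0 : 0 ≤ D 0 := by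
    have h := sqrt_mul_erfiProfile_le ht.le
    have e3 : ((0 : ℝ) + -1) / √(2 * t) = -(1 / √(2 * t)) := by ring
    simp only [D]
    rw [e3, erfiProfile_neg]
    simp only [zero_add, add_zero, zero_div, erfiProfile_zero]
    linarith
  have hhalf : (0 : ℝ) ≤ 1 / 2 := by norm_num
  have hmid := hconv.2 (Set.mem_univ s) (Set.mem_univ (-s)) hhalf hhalf (by norm_num)
  rw [heven] at hmid
  simp only [smul_eq_mul] at hmid
  have e : 1 / 2 * s + 1 / 2 * -s = 0 := by ring
  rw [e] at hmid
  have hs : 0 ≤ D s := by linarith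
  simp only [D, add_zero, ← sub_eq_add_neg] at hs
  linarith

/-! ### Growth of the erfi profile -/

theorem mul_exp_le_erfiInt {y : ℝ} (hy : 1 ≤ y) : (y - 1) * Real.exp ((y - 1) ^ 2) ≤ erfiInt y := by
  have hd : ∀ u : ℝ, HasDerivAt (fun y : ℝ => (y - 1) * Real.exp ((y - 1) ^ 2))
      (Real.exp ((u - 1) ^ 2) * (1 + 2 * (u - 1) ^ 2)) u := by
    intro u
    have h1 : HasDerivAt (fun y : ℝ => y - 1) 1 u := (hasDerivAt_id u).sub_const 1
    refine (h1.mul (h1.pow 2).exp).congr_deriv ?_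
    simp
    ring
  refine le_of_hasDerivAt_le (a := 1) hd hasDerivAt_erfiInt ?_ hy fun u hu _ => ?_
  · simpa using erfiInt_nonneg zero_le_one
  · have e : u ^ 2 = (u - 1) ^ 2 + (2 * (u - 1) + 1) := by ring
    rw [e, Real.exp_add]
    refine mul_le_mul_of_nonneg_left ?_ (Real.exp_pos _).le
    have := Real.quadratic_le_exp_of_nonneg (x := 2 * (u - 1) + 1) (by linarith)
    nlinarith

/-- The leading terms of the profile cancel, which leaves it below `exp(y²)` by a polynomial factor
at infinity. Shifting the argument by one absorbs this factor, and costs only an additive constant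
in the regret bracket. -/
theorem exp_sq_le_erfiProfile (y : ℝ) :
    Real.exp ((max 0 (y - 1)) ^ 2) ≤ 2 + erfiProfile (max 0 y) := by
  rcases le_total y 1 with h | h
  · rw [max_eq_left (by linarith)]
    have := neg_one_le_erfiProfile (max 0 y)
    simp
    linarith
  · rw [max_eq_right (by linarith), max_eq_right (by linarith)]
    have hd : ∀ u : ℝ, HasDerivAt (fun y : ℝ => Real.exp ((y - 1) ^ 2))
        (2 * ((u - 1) * Real.exp ((u - 1) ^ 2))) u := by
      intro u
      have h1 : HasDerivAt (fun y : ℝ => y - 1) 1 u := (hasDerivAt_id u).sub_const 1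
      refine (h1.pow 2).exp.congr_deriv ?_
      simp
      ring
    refine le_of_hasDerivAt_le (a := 1) hd
      (fun u => (hasDerivAt_erfiProfile u).const_add 2) ?_ h fun u hu _ => ?_
    · have := neg_one_le_erfiProfile 1
      simp
      linarith
    · linarith [mul_exp_le_erfiInt hu.le]

/-! ### The trace inequality for the erfi potential -/

section Mixture

variable {ι : Type*} [Fintype ι] {c a : ι → ℝ}

/-- A linear functional that is nonnegative on exponentials is nonnegative on `exp(θ x²)`. -/
theorem sum_mul_exp_sq_nonneg (h : ∀ η : ℝ, 0 ≤ ∑ k, c k * Real.exp (η * a k)) {θ : ℝ}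
    (hθ : 0 ≤ θ) : 0 ≤ ∑ k, c k * Real.exp (θ * a k ^ 2) := by
  -- Variance `2 θ` makes the moment generating function at `x` equal to `exp(θ x²)`.
  let γ := ProbabilityTheory.gaussianReal 0 (Real.toNNReal (2 * θ))
  have hm : ∀ k, Real.exp (θ * a k ^ 2) = ∫ z, Real.exp (a k * z) ∂γ := by
    intro k
    have := congrFun (ProbabilityTheory.mgf_id_gaussianReal (μ := 0)
      (v := (Real.toNNReal (2 * θ)))) (a k)
    simp only [ProbabilityTheory.mgf, id] at this
    rw [this, Real.coe_toNNReal _ (by positivity)]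
    congr 1
    ring
  have h1 : ∑ k, c k * Real.exp (θ * a k ^ 2) = ∫ z, ∑ k, c k * Real.exp (a k * z) ∂γ := by
    rw [MeasureTheory.integral_finsetSum]
    · refine Finset.sum_congr rfl fun k _ => ?_
      rw [hm k, MeasureTheory.integral_const_mul]
    · intro k _
      exact (ProbabilityTheory.integrable_exp_mul_gaussianReal (a k)).const_mul _
  rw [h1]
  refine MeasureTheory.integral_nonneg fun z => ?_
  have := h z
  simp only [mul_comm z] at this
  exact this

/-- A linear functional that is nonnegative on exponentials and vanishes on constants is
nonnegative on the erfi profile. -/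
theorem sum_mul_erfiProfile_nonneg (h : ∀ η : ℝ, 0 ≤ ∑ k, c k * Real.exp (η * a k))
    (h0 : ∑ k, c k = 0) : 0 ≤ ∑ k, c k * erfiProfile (a k) := by
  let M : ℝ → ℝ := fun v => ∑ k, c k * erfiProfile (v * a k)
  let M' : ℝ → ℝ := fun v => ∑ k, c k * (2 * erfiInt (v * a k) * a k)
  have hM : ∀ v, HasDerivAt M (M' v) v := by
    intro v
    refine HasDerivAt.fun_sum fun k _ => HasDerivAt.const_mul _ ?_
    have h1 : HasDerivAt (fun v => v * a k) (a k) v := by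
      simpa using (hasDerivAt_id v).mul_const (a k)
    exact (hasDerivAt_erfiProfile (v * a k)).comp v h1
  have hM0 : M 0 = 0 := by
    simp [M, erfiProfile_zero, h0]
  have hM'0 : M' 0 = 0 := by simp [M', erfiInt_zero]
  -- For the profile `E` one has `y E'(y) - E(y) = exp(y²)`, so `v M' - M` is the functional applied
  -- to `exp(v² x²)`. Thus `M v / v` increases from its limit `M' 0 = 0`.
  have hlin : ∀ v, M v ≤ v * M' v := by
    intro v
    have h1 := sum_mul_exp_sq_nonneg h (sq_nonneg v)
    have h2 : v * M' v - M v = ∑ k, c k * Real.exp (v ^ 2 * a k ^ 2) := by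
      simp only [M, M', Finset.mul_sum, ← Finset.sum_sub_distrib]
      refine Finset.sum_congr rfl fun k _ => ?_
      rw [erfiProfile, mul_pow]
      ring
    linarith
  have hmono : MonotoneOn (fun v => M v / v) (Set.Ioc 0 1) := by
    have hd : ∀ v ∈ Set.Ioc (0 : ℝ) 1,
        HasDerivAt (fun v => M v / v) ((M' v * v - M v * 1) / v ^ 2) v :=
      fun v hv => (hM v).div (hasDerivAt_id v) hv.1.ne'
    apply monotoneOn_of_deriv_nonneg (convex_Ioc 0 1)
      (fun x hx => (hd x hx).continuousAt.continuousWithinAt)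
      (fun x hx => (hd x (interior_subset hx)).differentiableAt.differentiableWithinAt)
    intro x hx
    rw [(hd x (interior_subset hx)).deriv]
    have := hlin x
    exact div_nonneg (by linarith) (sq_nonneg x)
  have hlim := (hasDerivWithinAt_iff_tendsto_slope' (s := Set.Ioi (0 : ℝ)) (by simp)).1
    (hM 0).hasDerivWithinAt
  rw [hM'0] at hlim
  have hfin : (0 : ℝ) ≤ M 1 := by
    refine le_of_tendsto hlim ?_
    filter_upwards [Ioc_mem_nhdsGT (zero_lt_one' ℝ)] with v hv
    rw [slope_def_field, hM0, sub_zero, sub_zero]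
    have := hmono hv (Set.right_mem_Ioc.2 zero_lt_one) hv.2
    simpa using this
  simpa [M] using hfin

end Mixture

/-- Against matrices diagonal in the basis `V`, only the diagonal of `V* C V` is seen; this makes
the chord bound a linear functional of scalar function values. -/
theorem exists_frob_conjDiag_eq {d : ℕ} {C V : CMat d} (hC : C.IsHermitian) :
    ∃ q : Fin d → ℝ, ∀ x : Fin d → ℝ, frob C (conjDiag V x) = ∑ j, q j * x j := by
  obtain ⟨W, _, γ, rfl⟩ := exists_eq_conjDiag hC
  refine ⟨fun j => ∑ i, overlap W V i j * γ i, fun x => ?_⟩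
  rw [frob_conjDiag_conjDiag, Finset.sum_comm]
  refine Finset.sum_congr rfl fun j _ => ?_
  rw [Finset.sum_mul]
  exact Finset.sum_congr rfl fun i _ => by ring

theorem one_sub_mul_self_posSemidef {d : ℕ} {R : CMat d} (hR : R.IsHermitian)
    (h1 : (1 - R).PosSemidef) (h2 : (1 + R).PosSemidef) : (1 - R * R).PosSemidef := by
  obtain ⟨V, hV, a, rfl⟩ := exists_eq_conjDiag hR
  have h : (1 : CMat d) = conjDiag V fun _ => 1 := by rw [conjDiag_const hV, one_smul]
  rw [h, conjDiag_sub, posSemidef_conjDiag_iff hV] at h1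
  rw [h, conjDiag_add, posSemidef_conjDiag_iff hV] at h2
  rw [h, conjDiag_mul hV, conjDiag_sub, posSemidef_conjDiag_iff hV]
  intro i
  nlinarith [h1 i, h2 i]

/-- The matrix version of convexity on `[s - ε, s + ε]`, under the trace, for the erfi profile. -/
theorem trace_erfiProfile_add_le {d : ℕ} {A C : CMat d} {ε κ ρ : ℝ} (hε : 0 < ε) (hκ : 0 ≤ κ)
    (hA : A.IsHermitian) (hC : C.IsHermitian) (h1 : (ε • 1 - C).PosSemidef)
    (h2 : (ε • 1 + C).PosSemidef) {φ : ℝ → ℝ} (hφ : ∀ x, φ x = κ * erfiProfile (x * ρ)) :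
    (cfc φ (A + C)).trace.re ≤
      ((cfc φ (A + ε • (1 : CMat d))).trace.re + (cfc φ (A - ε • (1 : CMat d))).trace.re) / 2
      + frob C ((2 * ε)⁻¹ •
        (cfc φ (A + ε • (1 : CMat d)) - cfc φ (A - ε • (1 : CMat d)))) := by
  have hACh := hA.add hC
  obtain ⟨W, hW, β, hβ⟩ := exists_eq_conjDiag hACh
  obtain ⟨V, hV, α, rfl⟩ := exists_eq_conjDiag hA
  obtain ⟨q, hq⟩ := exists_frob_conjDiag_eq (V := V) hC
  set R : CMat d := ε⁻¹ • C with hRdef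
  have hRC : C = ε • R := by rw [hRdef, smul_smul, mul_inv_cancel₀ hε.ne', one_smul]
  have hR : R.IsHermitian := isHermitian_smul hC _
  have hR1 : (1 - R * R).PosSemidef := by
    apply one_sub_mul_self_posSemidef hR
    · have := posSemidef_smul h1 (inv_nonneg.2 hε.le)
      rwa [smul_sub, smul_smul, inv_mul_cancel₀ hε.ne', one_smul] at this
    · have := posSemidef_smul h2 (inv_nonneg.2 hε.le)
      rwa [smul_add, smul_smul, inv_mul_cancel₀ hε.ne', one_smul] at this
  have hplus : conjDiag V α + ε • (1 : CMat d) = conjDiag V fun i => α i + ε := by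
    rw [← conjDiag_const hV, conjDiag_add]
  have hminus : conjDiag V α - ε • (1 : CMat d) = conjDiag V fun i => α i - ε := by
    rw [← conjDiag_const hV, conjDiag_sub]
  -- Weights and nodes of the functional sending `f` to the right side minus the left side of the
  -- claim, with `f` in place of `φ`: the nodes are the eigenvalues of `A + ε I`, `A - ε I` and `A +
  -- C`.
  let c : Fin d ⊕ (Fin d ⊕ Fin d) → ℝ :=
    Sum.elim (fun j => 1 / 2 + (2 * ε)⁻¹ * q j) (Sum.elim (fun j => 1 / 2 - (2 * ε)⁻¹ * q j)
      (fun _ => -1))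
  let x : Fin d ⊕ (Fin d ⊕ Fin d) → ℝ :=
    Sum.elim (fun j => α j + ε) (Sum.elim (fun j => α j - ε) β)
  have hsum : ∀ f : ℝ → ℝ, ∑ k, c k * f (x k)
      = ((∑ j, f (α j + ε)) + ∑ j, f (α j - ε)) / 2
        + (2 * ε)⁻¹ * (∑ j, q j * f (α j + ε) - ∑ j, q j * f (α j - ε)) - ∑ j, f (β j) := by
    intro f
    simp only [c, x, Fintype.sum_sum_type, Sum.elim_inl, Sum.elim_inr, add_mul, sub_mul, neg_mul,
      one_mul, Finset.sum_add_distrib, Finset.sum_sub_distrib, Finset.sum_neg_distrib, mul_assoc,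
      ← Finset.mul_sum]
    ring
  have hexp : ∀ η : ℝ, 0 ≤ ∑ k, c k * Real.exp (η * x k) := by
    intro η
    -- On exponentials the chord through `± ε` has the coefficients `cosh (η ε)` and `sinh (η ε)`,
    -- exactly those of the comparison solution.
    have h := trace_exp_add_smul_le (isHermitian_smul (conjDiag_isHermitian V α) η) hR hR1 (η * ε)
    have e : η • conjDiag V α + (η * ε) • R = η • conjDiag W β := by
      rw [← hβ, smul_add, mul_smul, ← hRC]
    rw [e, conjDiag_smul, conjDiag_smul, cfc_conjDiag hW, cfc_conjDiag hV, trace_conjDiag hW,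
      trace_conjDiag hV, hRdef, frob_smul_left, hq, Complex.ofReal_re, Complex.ofReal_re] at h
    rw [hsum fun y => Real.exp (η * y)]
    simp only [mul_add, mul_sub, Real.exp_add, Real.exp_sub]
    have e3 : Real.exp (-(η * ε)) = (Real.exp (η * ε))⁻¹ := Real.exp_neg _
    rw [Real.cosh_eq, Real.sinh_eq, e3] at h
    simp only [← mul_assoc, ← Finset.sum_mul, div_eq_mul_inv]
    rw [mul_inv]
    simp only [div_eq_mul_inv] at h
    nlinarith [h]
  have hconst : ∑ k, c k = 0 := by
    have := hsum fun _ => 1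
    simpa using this
  have hexp' : ∀ η : ℝ, 0 ≤ ∑ k, c k * Real.exp (η * (x k * ρ)) := by
    intro η
    have := hexp (η * ρ)
    refine this.trans_eq (Finset.sum_congr rfl fun k _ => ?_)
    congr 2
    ring
  have hmain := mul_nonneg hκ (sum_mul_erfiProfile_nonneg hexp' hconst)
  have hmain2 : 0 ≤ ∑ k, c k * φ (x k) := by
    refine hmain.trans_eq ?_
    rw [Finset.mul_sum]
    refine Finset.sum_congr rfl fun k _ => ?_
    rw [hφ]
    ring
  rw [hsum] at hmain2
  rw [hβ, hplus, hminus, cfc_conjDiag hW, cfc_conjDiag hV, cfc_conjDiag hV, frob_smul_right,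
    frob_sub_right, hq, hq, trace_conjDiag hW, trace_conjDiag hV, trace_conjDiag hV]
  simp only [Complex.ofReal_re]
  linarith

/-! ### The reduction to Hermitian matrices -/

theorem posSemidef_of_opNorm_le {d : ℕ} {G : CMat d} {l : ℝ} (hG : G.IsHermitian)
    (hl : opNorm G ≤ l) : (l • 1 - G).PosSemidef ∧ (l • 1 + G).PosSemidef := by
  have hb : ∀ i, |hG.eigenvalues i| ≤ l := by
    intro i
    have h1 := (Matrix.toEuclideanCLM (n := Fin d) (𝕜 := ℂ) G).le_opNorm (hG.eigenvectorBasis i)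
    have h2 : Matrix.toEuclideanCLM (n := Fin d) (𝕜 := ℂ) G (hG.eigenvectorBasis i)
        = (hG.eigenvalues i : ℂ) • hG.eigenvectorBasis i := by
      apply (WithLp.equiv 2 _).injective
      have := hG.mulVec_eigenvectorBasis i
      simpa using this
    rw [h2, norm_smul, hG.eigenvectorBasis.orthonormal.1 i, mul_one, mul_one, Complex.norm_real,
      Real.norm_eq_abs] at h1
    exact h1.trans hl
  have hV : (hG.eigenvectorUnitary : CMat d) ∈ Matrix.unitaryGroup (Fin d) ℂ :=
    hG.eigenvectorUnitary.2
  have he : G = conjDiag (hG.eigenvectorUnitary : CMat d) hG.eigenvalues := hG.spectral_theorem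
  rw [he, ← conjDiag_const hV, conjDiag_sub, conjDiag_add, posSemidef_conjDiag_iff hV,
    posSemidef_conjDiag_iff hV]
  exact ⟨fun i => by linarith [(abs_le.1 (hb i)).2], fun i => by linarith [(abs_le.1 (hb i)).1]⟩

theorem abs_frob_le_of_mem_spectraplex {d : ℕ} {G X : CMat d} {l : ℝ} (h1 : (l • 1 - G).PosSemidef)
    (h2 : (l • 1 + G).PosSemidef) (hX : X ∈ spectraplex d) : |frob G X| ≤ l := by
  have hX1 : frob 1 X = 1 := by rw [frob_one_left, hX.2]; rfl
  have h3 := frob_nonneg h1 hX.1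
  have h4 := frob_nonneg h2 hX.1
  rw [frob_sub_left, frob_smul_left, hX1] at h3
  rw [frob_add_left, frob_smul_left, hX1] at h4
  exact abs_le.2 ⟨by linarith, by linarith⟩

theorem maxMixed_mem_spectraplex {d : ℕ} (hd : 1 ≤ d) : maxMixed d ∈ spectraplex d := by
  refine ⟨posSemidef_smul_one (by positivity), ?_⟩
  have : (d : ℂ) ≠ 0 := by exact_mod_cast (by omega : d ≠ 0)
  simp [maxMixed, this]

theorem posPart_conjDiag {d : ℕ} {V : CMat d}
    (hV : V ∈ Matrix.unitaryGroup (Fin d) ℂ) (a : Fin d → ℝ) : posPart (conjDiag V a) = conjDiag V fun i => max 0 (a i) :=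
  cfc_conjDiag hV _ _

theorem negPart_conjDiag {d : ℕ} {V : CMat d}
    (hV : V ∈ Matrix.unitaryGroup (Fin d) ℂ) (a : Fin d → ℝ) : negPart (conjDiag V a) = conjDiag V fun i => min 0 (a i) :=
  cfc_conjDiag hV _ _

theorem posPart_conjDiag_eq_zero_iff {d : ℕ} {V : CMat d}
    (hV : V ∈ Matrix.unitaryGroup (Fin d) ℂ) (a : Fin d → ℝ) :
    posPart (conjDiag V a) = 0 ↔ ∑ i, max 0 (a i) = 0 := by
  rw [posPart_conjDiag hV]
  constructor
  · intro h
    have := trace_conjDiag hV fun i => max 0 (a i)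
    rw [h, Matrix.trace_zero] at this
    exact_mod_cast this.symm
  · intro h
    have h0 : ∀ i, max 0 (a i) = 0 := fun i =>
      (Finset.sum_eq_zero_iff_of_nonneg fun i _ => le_max_left 0 (a i)).1 h i (Finset.mem_univ i)
    simp only [h0]
    rw [conjDiag_const hV, zero_smul]

theorem negDirection_conjDiag {d : ℕ} {V : CMat d}
    (hV : V ∈ Matrix.unitaryGroup (Fin d) ℂ) (a : Fin d → ℝ) : negDirection (conjDiag V a)
    = conjDiag V fun i => |∑ j, min 0 (a j)|⁻¹ * min 0 (a i) := by
  rw [negDirection, negPart_conjDiag hV, trace_conjDiag hV, Complex.ofReal_re, conjDiag_smul]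

theorem isHermitian_posPart {d : ℕ} {A : CMat d} (hA : A.IsHermitian) :
    (posPart A).IsHermitian := by
  obtain ⟨V, hV, a, rfl⟩ := exists_eq_conjDiag hA
  rw [posPart_conjDiag hV]
  exact conjDiag_isHermitian _ _

theorem normalizedPos_mem_spectraplex {d : ℕ} (hd : 1 ≤ d) {A : CMat d} (hA : A.IsHermitian) :
    normalizedPos A ∈ spectraplex d := by
  unfold normalizedPos
  split_ifs with h
  · exact maxMixed_mem_spectraplex hd
  · obtain ⟨V, hV, a, rfl⟩ := exists_eq_conjDiag hA
    rw [posPart_conjDiag_eq_zero_iff hV] at h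
    rw [posPart_conjDiag hV, trace_conjDiag hV, Complex.ofReal_re, conjDiag_smul]
    refine ⟨(posSemidef_conjDiag_iff hV _).2 fun i => ?_, ?_⟩
    · have : 0 ≤ ∑ i, max 0 (a i) := Finset.sum_nonneg fun i _ => le_max_left _ _
      have := le_max_left 0 (a i)
      positivity
    · rw [trace_conjDiag hV, ← Finset.mul_sum, inv_mul_cancel₀ h]
      simp

/-- Admitting the scalar `0` covers the default prediction too, so orthogonality of the centred loss
to the prediction always passes to the positive part. -/
theorem exists_posPart_eq_smul_normalizedPos {d : ℕ} (A : CMat d) (hA : A.IsHermitian) :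
    ∃ k : ℝ, posPart A = k • normalizedPos A := by
  unfold normalizedPos
  split_ifs with h
  · exact ⟨0, by rw [h, zero_smul]⟩
  · refine ⟨(posPart A).trace.re, ?_⟩
    obtain ⟨V, hV, a, rfl⟩ := exists_eq_conjDiag hA
    rw [posPart_conjDiag_eq_zero_iff hV] at h
    rw [smul_smul, posPart_conjDiag hV, trace_conjDiag hV, Complex.ofReal_re, mul_inv_cancel₀ h,
      one_smul]

/-- The positive and negative parts live on different eigenvectors, hence the orthogonality. Without
negative eigenvalues `0⁻¹ = 0` gives the zero matrix, the first alternative. -/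
theorem negDirection_spec {d : ℕ} {A : CMat d} (hA : A.IsHermitian) :
    (-negDirection A).PosSemidef ∧ (1 + negDirection A).PosSemidef ∧
      (negDirection A = 0 ∨ (negDirection A).trace.re = -1) ∧
      frob (negDirection A) (posPart A) = 0 := by
  obtain ⟨V, hV, a, rfl⟩ := exists_eq_conjDiag hA
  have hnp : ∀ i, min 0 (a i) ≤ 0 := fun i => min_le_left _ _
  have hs : ∑ j, min 0 (a j) ≤ 0 := Finset.sum_nonpos fun i _ => hnp i
  have hle : ∀ i, ∑ j, min 0 (a j) ≤ min 0 (a i) := fun i => by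
    have := Finset.single_le_sum (f := fun j => -min 0 (a j)) (fun j _ => neg_nonneg.2 (hnp j))
      (Finset.mem_univ i)
    rw [Finset.sum_neg_distrib] at this
    linarith
  have hone : (1 : CMat d) = conjDiag V fun _ => 1 := by rw [conjDiag_const hV, one_smul]
  have hinv : 0 ≤ |∑ j, min 0 (a j)|⁻¹ := by positivity
  rw [negDirection_conjDiag hV]
  refine ⟨?_, ?_, ?_, ?_⟩
  · rw [← neg_one_smul ℝ, conjDiag_smul, posSemidef_conjDiag_iff hV]
    intro i
    have := mul_nonneg hinv (neg_nonneg.2 (hnp i))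
    linarith
  · rw [hone, conjDiag_add, posSemidef_conjDiag_iff hV]
    intro i
    have h1 : |∑ j, min 0 (a j)|⁻¹ * (-min 0 (a i)) ≤ 1 := by
      rw [abs_of_nonpos hs]
      have h2 := mul_le_mul_of_nonneg_left (neg_le_neg (hle i))
        (inv_nonneg.2 (neg_nonneg.2 hs))
      exact h2.trans inv_mul_le_one
    linarith
  · rw [trace_conjDiag hV, Complex.ofReal_re, ← Finset.mul_sum]
    by_cases h : ∑ j, min 0 (a j) = 0
    · left
      simp only [h, abs_zero, inv_zero, zero_mul]
      rw [conjDiag_const hV, zero_smul]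
    · right
      rw [abs_of_nonpos hs, inv_neg, neg_mul, inv_mul_cancel₀ h]
  · rw [posPart_conjDiag hV, frob, conjDiag_mul hV, trace_conjDiag hV, Complex.ofReal_re]
    refine Finset.sum_eq_zero fun i _ => ?_
    rcases le_total 0 (a i) with h | h <;> simp [h]

/-- The case distinction disappears, since the default value of `U` is zero when no eigenvalue is
negative. The proof and the branch-free program both rely on this. -/
theorem surrogateLoss_eq {d : ℕ} {A G : CMat d} (hA : A.IsHermitian) :
    surrogateLoss A G = (G - frob G (normalizedPos A) • (1 : CMat d))
      - min 0 (frob (G - frob G (normalizedPos A) • (1 : CMat d)) (negDirection A))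
        • negDirection A := by
  unfold surrogateLoss
  split_ifs with h
  · have h0 : negDirection A = 0 := by
      obtain ⟨V, hV, a, rfl⟩ := exists_eq_conjDiag hA
      rw [posSemidef_conjDiag_iff hV] at h
      rw [negDirection_conjDiag hV]
      simp only [min_eq_left (h _), mul_zero]
      rw [conjDiag_const hV, zero_smul]
    rw [h0, smul_zero, sub_zero]
  · rfl

/-- Properties of the surrogate loss: it is bounded in the operator norm, it vanishes at the
positive part of the base prediction, and it dominates the linearized regret. -/
theorem surrogateLoss_spec {d : ℕ} (hd : 1 ≤ d) {A G : CMat d} {l : ℝ} (hA : A.IsHermitian)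
    (hG : G.IsHermitian) (hl : opNorm G ≤ l) :
    (surrogateLoss A G).IsHermitian ∧
      ((2 * l) • 1 - -surrogateLoss A G).PosSemidef ∧
      ((2 * l) • 1 + -surrogateLoss A G).PosSemidef ∧
      frob (-surrogateLoss A G) (posPart A) = 0 ∧
      ∀ X ∈ spectraplex d,
        frob G (normalizedPos A) - frob G X ≤ frob (-surrogateLoss A G) X := by
  obtain ⟨hG1, hG2⟩ := posSemidef_of_opNorm_le hG hl
  obtain ⟨hU1, hU2, hU3, hU4⟩ := negDirection_spec hA
  have hX := normalizedPos_mem_spectraplex hd hA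
  have hγ := abs_le.1 (abs_frob_le_of_mem_spectraplex hG1 hG2 hX)
  rw [surrogateLoss_eq hA]
  set γ := frob G (normalizedPos A) with hγdef
  set U := negDirection A with hUdef
  set m := min 0 (frob (G - γ • (1 : CMat d)) U) with hm
  have hm0 : m ≤ 0 := min_le_left _ _
  -- Since `-U` is zero or a density matrix, pairing it with `l I - G` bounds the correction. The
  -- room left is just enough for norm `2 * l`, whence `ε = 2 l`.
  have hml : -m ≤ l - γ := by
    rcases min_choice 0 (frob (G - γ • (1 : CMat d)) U) with h | h
    · rw [hm, h]; linarith [hγ.2]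
    · rw [hm, h]
      rcases hU3 with h0 | h1
      · rw [h0, frob_zero_right]; linarith [hγ.2]
      · have h3 := frob_nonneg hG1 hU1
        rw [frob_sub_left, frob_smul_left, frob_one_left, Matrix.trace_neg, Complex.neg_re, h1,
          ← neg_one_smul ℝ U, frob_smul_right] at h3
        rw [frob_sub_left, frob_smul_left, frob_one_left, h1]
        linarith
  refine ⟨?_, ?_, ?_, ?_, ?_⟩
  · refine (hG.sub (isHermitian_smul Matrix.isHermitian_one _)).sub (isHermitian_smul ?_ _)
    have := hU1.1.neg
    rwa [neg_neg] at this
  · have e : (2 * l) • 1 - -((G - γ • (1 : CMat d)) - m • U)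
        = ((l • 1 + G) + (l - γ - -m) • (1 : CMat d)) + (-m) • (1 + U) := by module
    rw [e]
    exact (hG2.add (posSemidef_smul_one (by linarith))).add (posSemidef_smul hU2 (by linarith))
  · have e : (2 * l) • 1 + -((G - γ • (1 : CMat d)) - m • U)
        = ((l • 1 - G) + (l + γ) • (1 : CMat d)) + (-m) • (-U) := by module
    rw [e]
    exact (hG1.add (posSemidef_smul_one (by linarith))).add (posSemidef_smul hU1 (by linarith))
  · obtain ⟨k, hk⟩ := exists_posPart_eq_smul_normalizedPos A hA
    have h1 : frob (G - γ • (1 : CMat d)) (posPart A) = 0 := by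
      rw [hk, frob_smul_right, frob_sub_left, frob_smul_left, frob_one_left, hX.2, ← hγdef]
      simp
    rw [frob_neg_left, frob_sub_left, h1, frob_smul_left, hU4]
    simp
  · intro X hX'
    have h1 : 0 ≤ m * frob U X := by
      have := frob_nonneg hU1 hX'.1
      rw [frob_neg_left] at this
      nlinarith
    rw [frob_neg_left, frob_sub_left, frob_sub_left, frob_smul_left, frob_smul_left, frob_one_left,
      hX'.2]
    simp
    linarith

/-! ### The regret bound -/

theorem erfiProfile_le_of_abs_le {a b : ℝ} (h : |a| ≤ |b|) : erfiProfile a ≤ erfiProfile b := by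
  have habs : ∀ x, erfiProfile |x| = erfiProfile x := by
    intro x
    rcases abs_choice x with h | h <;> rw [h]
    exact erfiProfile_neg x
  rw [← habs a, ← habs b]
  have h1 := erfiProfile_add_le |a| |b|
  have h2 := mul_nonneg (erfiInt_nonneg (abs_nonneg a)) (sub_nonneg.2 h)
  linarith

section Potential

variable {d : ℕ} {ε : ℝ}

theorem erfiPotential_eq_mul (d : ℕ) (ε : ℝ) (t : ℕ) (s : ℝ) :
    erfiPotential d ε t s
      = (ε * √(t : ℝ) / d) * erfiProfile (s * (√(2 * ε ^ 2 * t))⁻¹) := by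
  rw [erfiPotential_eq, div_eq_mul_inv s]

theorem erfiPotential_le_of_abs_le (d : ℕ) (hε : 0 < ε) (t : ℕ) {a b : ℝ} (h : |a| ≤ |b|) :
    erfiPotential d ε t a ≤ erfiPotential d ε t b := by
  rw [erfiPotential_eq_mul, erfiPotential_eq_mul]
  refine mul_le_mul_of_nonneg_left (erfiProfile_le_of_abs_le ?_) (by positivity)
  rw [abs_mul, abs_mul]
  exact mul_le_mul_of_nonneg_right h (abs_nonneg _)

/-- The discrete Itô inequality for the erfi potential. -/
theorem average_erfiPotential_le (d : ℕ) (hε : 0 < ε) (n : ℕ) {s : ℝ} (hs : n = 0 → s = 0) :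
    (erfiPotential d ε (n + 1) (s + ε) + erfiPotential d ε (n + 1) (s - ε)) / 2 ≤
      erfiPotential d ε n s := by
  have hsqrt : ∀ t : ℝ, √(2 * ε ^ 2 * t) = ε * √(2 * t) := by
    intro t
    rw [show 2 * ε ^ 2 * t = ε ^ 2 * (2 * t) by ring, Real.sqrt_mul (sq_nonneg ε),
      Real.sqrt_sq hε.le]
  have hdiv : ∀ x t : ℝ, x / √(2 * ε ^ 2 * t) = (x / ε) / √(2 * t) := by
    intro x t
    rw [hsqrt, div_div]
  simp only [erfiPotential_eq, hdiv, Nat.cast_add, Nat.cast_one, add_div, sub_div,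
    div_self hε.ne']
  have key : (√((n : ℝ) + 1) * erfiProfile ((s / ε + 1) / √(2 * ((n : ℝ) + 1)))
      + √((n : ℝ) + 1) * erfiProfile ((s / ε - 1) / √(2 * ((n : ℝ) + 1)))) / 2 ≤
      √(n : ℝ) * erfiProfile (s / ε / √(2 * n)) := by
    -- At time `0` the potential vanishes identically because of its factor `√0`; the inequality is
    -- then needed, and supplied, only at `s = 0`.
    rcases Nat.eq_zero_or_pos n with h0 | hpos
    · have h := sqrt_mul_erfiProfile_le (t := 1) le_rfl
      subst h0
      rw [hs rfl]
      have e : ((0 : ℝ) / ε - 1) / √(2 * (((0 : ℕ) : ℝ) + 1)) = -(1 / √(2 * 1)) := by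
        simp [neg_div]
      rw [e, erfiProfile_neg]
      simp at h ⊢
      linarith
    · have hn : (1 : ℝ) < (n : ℝ) + 1 := by
        have : (0 : ℝ) < n := by exact_mod_cast hpos
        linarith
      have h := average_sqrt_mul_erfiProfile_le hn (s / ε)
      simpa using h
  have := mul_le_mul_of_nonneg_left key (show 0 ≤ ε / d by positivity)
  simp only [add_div] at this
  refine le_trans (le_of_eq ?_) (this.trans (le_of_eq ?_)) <;> ring_nf

end Potential

/-- The base prediction of the potential algorithm of the erfi potential. -/
def erfiBase (d : ℕ) (ε : ℝ) (t : ℕ) (S : CMat d) : CMat d :=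
  (potentialAlgorithm d ε (erfiPotential d ε)).predict t S

theorem erfiBase_conjDiag {d : ℕ} {V : CMat d} (hV : V ∈ Matrix.unitaryGroup (Fin d) ℂ) (ε : ℝ)
    (t : ℕ) (s : Fin d → ℝ) : erfiBase d ε t (conjDiag V s) = conjDiag V fun i =>
      (2 * ε)⁻¹ * (erfiPotential d ε t (s i + ε) - erfiPotential d ε t (s i - ε)) := by
  simp only [erfiBase, potentialAlgorithm]
  rw [← conjDiag_const hV, conjDiag_add, conjDiag_sub, cfc_conjDiag hV, cfc_conjDiag hV,
    conjDiag_sub, conjDiag_smul]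

theorem isHermitian_erfiBase {d : ℕ} (ε : ℝ) (t : ℕ) {S : CMat d} (hS : S.IsHermitian) :
    (erfiBase d ε t S).IsHermitian := by
  obtain ⟨V, hV, s, rfl⟩ := exists_eq_conjDiag hS
  rw [erfiBase_conjDiag hV]
  exact conjDiag_isHermitian _ _

/-- The potential is even and nondecreasing in `|s|`, so its symmetric difference is nonnegative for
`s ≥ 0`, nonpositive for `s ≤ 0`, and zero at `0`. This links the truncated potential to the
truncation of the prediction. -/
theorem posPart_erfiBase {d : ℕ} {ε : ℝ} (hε : 0 < ε) (t : ℕ) {S : CMat d} (hS : S.IsHermitian) :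
    posPart (erfiBase d ε t S) = erfiBase d ε t (posPart S) := by
  obtain ⟨V, hV, s, rfl⟩ := exists_eq_conjDiag hS
  rw [posPart_conjDiag hV, erfiBase_conjDiag hV, erfiBase_conjDiag hV, posPart_conjDiag hV]
  congr 1
  funext i
  have hinv : (0 : ℝ) < (2 * ε)⁻¹ := by positivity
  rcases le_total 0 (s i) with h | h
  · rw [max_eq_right h, max_eq_right]
    refine mul_nonneg hinv.le (sub_nonneg.2 (erfiPotential_le_of_abs_le d hε t ?_))
    rw [abs_of_nonneg (a := s i + ε) (by linarith)]
    exact abs_le.2 ⟨by linarith, by linarith⟩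
  · rw [max_eq_left h, max_eq_left]
    · have := erfiPotential_le_of_abs_le d hε t (a := 0 + ε) (b := 0 - ε) (by simp)
      have := erfiPotential_le_of_abs_le d hε t (a := 0 - ε) (b := 0 + ε) (by simp)
      have e : erfiPotential d ε t (0 + ε) = erfiPotential d ε t (0 - ε) := by linarith
      rw [e, sub_self, mul_zero]
    · refine mul_nonpos_of_nonneg_of_nonpos hinv.le
        (sub_nonpos.2 (erfiPotential_le_of_abs_le d hε t ?_))
      rw [abs_of_nonpos (a := s i - ε) (by linarith)]
      exact abs_le.2 ⟨by linarith, by linarith⟩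

/-- The trace of the potential of the positive part of a matrix. -/
def tracePotential (d : ℕ) (ε : ℝ) (t : ℕ) (S : CMat d) : ℝ :=
  (cfc (fun s => erfiPotential d ε t (max 0 s)) S).trace.re

/-- The state is first replaced by its positive part, then the truncation inside the new potential
is dropped; at the truncated state the chord bound and, eigenvalue by eigenvalue, the Itô inequality
apply. -/
theorem tracePotential_le {d : ℕ} {ε : ℝ} (hε : 0 < ε) (n : ℕ) {S C : CMat d}
    (hS : S.IsHermitian) (hS0 : n = 0 → S = 0) (hC : C.IsHermitian)
    (h1 : (ε • 1 - C).PosSemidef) (h2 : (ε • 1 + C).PosSemidef) :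
    tracePotential d ε (n + 1) (S + C) ≤
      tracePotential d ε n S + frob C (posPart (erfiBase d ε (n + 1) S)) := by
  have hP := isHermitian_posPart hS
  rw [posPart_erfiBase hε _ hS]
  have hmono : tracePotential d ε (n + 1) (S + C)
      ≤ tracePotential d ε (n + 1) (posPart S + C) := by
    set ρ := (√(2 * ε ^ 2 * ((n + 1 : ℕ) : ℝ)))⁻¹ with hρ
    have hρ0 : 0 ≤ ρ := by positivity
    set κ := ε * √((n + 1 : ℕ) : ℝ) / d with hκ
    have hκ0 : 0 ≤ κ := by positivity
    refine trace_cfc_mono (f' := fun s => κ * (2 * erfiInt (max 0 s * ρ) * ρ))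
      (fun a b => ?_) (fun a => ?_) (hS.add hC) (hP.add hC) ?_
    · rw [erfiPotential_eq_mul, erfiPotential_eq_mul, ← hρ, ← hκ]
      have h := mul_le_mul_of_nonneg_left (erfiProfile_add_le (max 0 a * ρ) (max 0 b * ρ)) hκ0
      refine le_trans ?_ h
      -- The proposed slope is zero for `a ≤ 0`, which is why truncation keeps the potential convex
      -- and makes it monotone.
      have h3 : erfiInt (max 0 a * ρ) * (b - a) ≤ erfiInt (max 0 a * ρ) * (max 0 b - max 0 a) := by
        rcases le_total 0 a with ha | ha
        · rw [max_eq_right ha]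
          refine mul_le_mul_of_nonneg_left ?_ (erfiInt_nonneg (mul_nonneg ha hρ0))
          linarith [le_max_right 0 b]
        · rw [max_eq_left ha, zero_mul, erfiInt_zero, zero_mul, zero_mul]
      have h4 := mul_le_mul_of_nonneg_left h3 (mul_nonneg hκ0 hρ0)
      linarith
    · have := erfiInt_nonneg (mul_nonneg (le_max_left 0 a) hρ0)
      positivity
    · have e : posPart S + C - (S + C) = posPart S - S := by abel
      rw [e]
      obtain ⟨V, hV, s, rfl⟩ := exists_eq_conjDiag hS
      rw [posPart_conjDiag hV, conjDiag_sub, posSemidef_conjDiag_iff hV]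
      exact fun i => sub_nonneg.2 (le_max_right _ _)
  have hdrop : tracePotential d ε (n + 1) (posPart S + C)
      ≤ (cfc (erfiPotential d ε (n + 1)) (posPart S + C)).trace.re := by
    obtain ⟨W, hW, β, hβ⟩ := exists_eq_conjDiag (hP.add hC)
    rw [tracePotential, hβ, cfc_conjDiag hW, cfc_conjDiag hW, trace_conjDiag hW, trace_conjDiag hW,
      Complex.ofReal_re, Complex.ofReal_re]
    refine Finset.sum_le_sum fun i _ => erfiPotential_le_of_abs_le d hε _ ?_
    rcases le_total 0 (β i) with h | h
    · rw [max_eq_right h]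
    · rw [max_eq_left h, abs_zero]; exact abs_nonneg _
  have hstep := trace_erfiProfile_add_le hε (κ := ε * √((n + 1 : ℕ) : ℝ) / d) (by positivity)
    hP hC h1 h2 (erfiPotential_eq_mul d ε (n + 1))
  have hito : ((cfc (erfiPotential d ε (n + 1)) (posPart S + ε • (1 : CMat d))).trace.re
      + (cfc (erfiPotential d ε (n + 1)) (posPart S - ε • (1 : CMat d))).trace.re) / 2
      ≤ tracePotential d ε n S := by
    obtain ⟨V, hV, s, rfl⟩ := exists_eq_conjDiag hS
    have hs : n = 0 → ∀ i, s i = 0 := by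
      intro h i
      have h0 := hS0 h
      rw [← zero_smul ℝ (1 : CMat d), ← conjDiag_const hV] at h0
      exact congrFun (conjDiag_injective hV h0) i
    rw [posPart_conjDiag hV, ← conjDiag_const hV, conjDiag_add, conjDiag_sub, cfc_conjDiag hV,
      cfc_conjDiag hV, tracePotential, cfc_conjDiag hV, trace_conjDiag hV, trace_conjDiag hV,
      trace_conjDiag hV]
    simp only [Complex.ofReal_re]
    rw [← Finset.sum_add_distrib, Finset.sum_div]
    refine Finset.sum_le_sum fun i _ => average_erfiPotential_le d hε n fun h => ?_
    rw [hs h i, max_self]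
  have hbase : erfiBase d ε (n + 1) (posPart S) = (2 * ε)⁻¹ •
      (cfc (erfiPotential d ε (n + 1)) (posPart S + ε • (1 : CMat d))
        - cfc (erfiPotential d ε (n + 1)) (posPart S - ε • (1 : CMat d))) := rfl
  rw [hbase]
  linarith

/-- The state of the algorithm after `n` rounds. -/
def erfiState (d : ℕ) (l : ℝ) (G : ℕ → CMat d) (n : ℕ) : CMat d := (erfiLEA d l).stateAfter G n

theorem erfiState_zero (d : ℕ) (l : ℝ) (G : ℕ → CMat d) : erfiState d l G 0 = 0 := rfl

theorem erfiState_succ (d : ℕ) (l : ℝ) (G : ℕ → CMat d) (n : ℕ) :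
    erfiState d l G (n + 1) = erfiState d l G n
      - surrogateLoss (erfiBase d (2 * l) (n + 1) (erfiState d l G n)) (G (n + 1)) := rfl

theorem play_erfiLEA (d : ℕ) (l : ℝ) (G : ℕ → CMat d) (t : ℕ) :
    (erfiLEA d l).play G t = normalizedPos (erfiBase d (2 * l) t (erfiState d l G (t - 1))) := rfl

/-- The induction closes because the linear term in `tracePotential_le` pairs the surrogate loss
with the positive part of the base prediction, and this pairing is zero. -/
theorem erfiState_spec {d : ℕ} {l : ℝ} (hd : 1 ≤ d) (hl : 0 < l) {T : ℕ} {G : ℕ → CMat d}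
    (hG : ∀ t ∈ Finset.Icc 1 T, (G t).IsHermitian ∧ opNorm (G t) ≤ l) {n : ℕ} (hn : n ≤ T) :
    (erfiState d l G n).IsHermitian ∧ tracePotential d (2 * l) n (erfiState d l G n) ≤ 0 ∧
      ∀ X ∈ spectraplex d, regret G ((erfiLEA d l).play G) n X ≤ frob (erfiState d l G n) X := by
  induction n with
  | zero =>
    rw [erfiState_zero]
    refine ⟨Matrix.isHermitian_zero, le_of_eq ?_, fun X _ => ?_⟩
    · have h : (fun s => erfiPotential d (2 * l) 0 (max 0 s)) = fun _ => (0 : ℝ) := by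
        funext s
        simp [erfiPotential]
      have h0 : (0 : CMat d) = conjDiag 1 fun _ => 0 := by
        rw [conjDiag_const (one_mem _), zero_smul]
      rw [tracePotential, h, h0, cfc_conjDiag (one_mem _), ← h0]
      simp
    · simp [regret, frob]
  | succ n ih =>
    obtain ⟨hS, hΨ, hreg⟩ := ih (by omega)
    obtain ⟨hGh, hGn⟩ := hG (n + 1) (Finset.mem_Icc.2 ⟨by omega, hn⟩)
    have hA := isHermitian_erfiBase (2 * l) (n + 1) hS
    obtain ⟨hL, hL1, hL2, hL3, hL4⟩ := surrogateLoss_spec hd hA hGh hGn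
    rw [erfiState_succ, sub_eq_add_neg]
    refine ⟨hS.add hL.neg, ?_, fun X hX => ?_⟩
    · have h := tracePotential_le (by linarith) n hS
        (fun h => by rw [h, erfiState_zero]) hL.neg hL1 hL2
      rw [hL3] at h
      linarith
    · have h1 := hreg X hX
      have h2 := hL4 X hX
      have h3 : regret G ((erfiLEA d l).play G) (n + 1) X
          = regret G ((erfiLEA d l).play G) n X
            + (frob (G (n + 1)) ((erfiLEA d l).play G (n + 1)) - frob (G (n + 1)) X) := by
        simp only [regret, Finset.sum_Icc_succ_top (show 1 ≤ n + 1 by omega)]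
        ring
      rw [h3, frob_add_left, play_erfiLEA, Nat.add_sub_cancel]
      linarith

/-! ### From the potential to the relative entropy -/

theorem relEntropy_conjDiag_maxMixed {d : ℕ} {W : CMat d}
    (hW : W ∈ Matrix.unitaryGroup (Fin d) ℂ) (x : Fin d → ℝ) :
    relEntropy (conjDiag W x) (maxMixed d) = ∑ i, x i * (Real.log (x i) + Real.log d) := by
  rw [relEntropy, maxMixed, ← conjDiag_const hW, cfc_conjDiag hW, cfc_conjDiag hW, conjDiag_sub,
    frob, conjDiag_mul hW, trace_conjDiag hW, Complex.ofReal_re]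
  simp [Real.log_inv]

/-- The Fenchel–Young inequality for `x log x - x` and its conjugate `exp`. -/
theorem mul_le_mul_log_add_exp {a b : ℝ} (ha : 0 ≤ a) :
    a * b ≤ a * Real.log a - a + Real.exp b := by
  rcases ha.eq_or_lt with h | h
  · rw [← h]
    simpa using (Real.exp_pos b).le
  · have h1 := mul_le_mul_of_nonneg_left (Real.add_one_le_exp (b - Real.log a)) ha
    rw [Real.exp_sub, Real.exp_log h, mul_div_cancel₀ _ h.ne'] at h1
    linarith

/-- The Gibbs variational inequality for the relative entropy to the maximally mixed state. -/
theorem sum_overlap_mul_le_relEntropy {d : ℕ} (hd : 1 ≤ d) {V W : CMat d}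
    (hV : V ∈ Matrix.unitaryGroup (Fin d) ℂ) (hW : W ∈ Matrix.unitaryGroup (Fin d) ℂ)
    {x : Fin d → ℝ} (hx : ∀ i, 0 ≤ x i) (hx1 : ∑ i, x i = 1) (h : Fin d → ℝ) {b : ℝ}
    (hb : ∑ j, Real.exp (h j) ≤ d * Real.exp b) :
    ∑ i, ∑ j, overlap W V i j * (x i * h j) ≤ relEntropy (conjDiag W x) (maxMixed d) + b := by
  have hd0 : (0 : ℝ) < d := by exact_mod_cast hd
  have hpt : ∀ i j, x i * h j ≤ x i * (Real.log (x i) + Real.log d) + (b - 1) * x i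
      + Real.exp (h j) * (Real.exp (-b) / d) := by
    intro i j
    have h1 := mul_le_mul_log_add_exp (a := x i * d) (b := h j - b) (mul_nonneg (hx i) hd0.le)
    have h2 : x i * d * Real.log (x i * d) = x i * d * (Real.log (x i) + Real.log d) := by
      rcases (hx i).eq_or_lt with h0 | h0
      · rw [← h0]; simp
      · rw [Real.log_mul h0.ne' hd0.ne']
    rw [h2, sub_eq_add_neg (h j), Real.exp_add] at h1
    have h3 : d * (x i * h j) ≤ d * (x i * (Real.log (x i) + Real.log d) + (b - 1) * x i
        + Real.exp (h j) * (Real.exp (-b) / d)) := by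
      have e : (d : ℝ) * (Real.exp (h j) * (Real.exp (-b) / d))
          = Real.exp (h j) * Real.exp (-b) := by
        field_simp
      rw [mul_add, mul_add, e]
      linarith
    exact le_of_mul_le_mul_left h3 hd0
  have hsum : ∑ i, ∑ j, overlap W V i j * (x i * h j)
      ≤ ∑ i, ∑ j, (overlap W V i j * (x i * (Real.log (x i) + Real.log d) + (b - 1) * x i)
        + overlap W V i j * (Real.exp (h j) * (Real.exp (-b) / d))) := by
    refine Finset.sum_le_sum fun i _ => Finset.sum_le_sum fun j _ => ?_
    rw [← mul_add]
    exact mul_le_mul_of_nonneg_left (hpt i j) (overlap_nonneg _ _ _ _)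
  simp only [Finset.sum_add_distrib] at hsum
  rw [← sum_eq_sum_overlap_left hW hV, ← sum_eq_sum_overlap_right hW hV (fun j =>
    Real.exp (h j) * (Real.exp (-b) / d)), Finset.sum_add_distrib, ← Finset.mul_sum,
    ← Finset.sum_mul, hx1, ← relEntropy_conjDiag_maxMixed hW] at hsum
  have hlast : (∑ j, Real.exp (h j)) * (Real.exp (-b) / d) ≤ 1 := by
    calc _ ≤ d * Real.exp b * (Real.exp (-b) / d) :=
          mul_le_mul_of_nonneg_right hb (by positivity)
      _ = Real.exp b * Real.exp (-b) := by field_simp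
      _ = 1 := by rw [← Real.exp_add]; simp
  linarith

theorem relEntropy_maxMixed_nonneg {d : ℕ} (hd : 1 ≤ d) {X : CMat d} (hX : X ∈ spectraplex d) :
    0 ≤ relEntropy X (maxMixed d) := by
  obtain ⟨hX, hX1⟩ := hX
  obtain ⟨W, hW, x, rfl⟩ := exists_eq_conjDiag hX.1
  rw [posSemidef_conjDiag_iff hW] at hX
  rw [trace_conjDiag hW] at hX1
  have h := sum_overlap_mul_le_relEntropy hd hW hW hX (by exact_mod_cast hX1) (fun _ => 0)
    (b := 0) (by simp)
  simpa using h

/-- The weights `overlap W V i j * x i` form a probability distribution under which `⟨S, X⟩` is the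
mean of the eigenvalues of `S`. In units of `r` these are at most `1 + w j`, and the Gibbs
inequality bounds the second moment of `w`. -/
theorem frob_le_of_tracePotential_nonpos {d : ℕ} (hd : 1 ≤ d) {ε : ℝ} (hε : 0 < ε) {T : ℕ}
    (hT : 1 ≤ T) {S X : CMat d} (hS : S.IsHermitian) (hX : X ∈ spectraplex d)
    (hΨ : tracePotential d ε T S ≤ 0) :
    frob S X ≤ ε * √2 * √(T : ℝ) * (√(relEntropy X (maxMixed d)) + 2) := by
  have hE := relEntropy_maxMixed_nonneg hd hX
  obtain ⟨hX, hX1⟩ := hX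
  obtain ⟨V, hV, s, rfl⟩ := exists_eq_conjDiag hS
  obtain ⟨W, hW, x, rfl⟩ := exists_eq_conjDiag hX.1
  rw [posSemidef_conjDiag_iff hW] at hX
  rw [trace_conjDiag hW] at hX1
  have hx1 : ∑ i, x i = 1 := by exact_mod_cast hX1
  set E := relEntropy (conjDiag W x) (maxMixed d)
  have hT0 : (0 : ℝ) < T := by exact_mod_cast hT
  have hd0 : (0 : ℝ) < d := by exact_mod_cast hd
  set r := √(2 * ε ^ 2 * (T : ℝ)) with hr
  have hr0 : 0 < r := Real.sqrt_pos.2 (by positivity)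
  have hreq : r = ε * √2 * √(T : ℝ) := by
    rw [hr, Real.sqrt_mul (by positivity), Real.sqrt_mul (by norm_num), Real.sqrt_sq hε.le]
    ring
  set y : Fin d → ℝ := fun j => s j / r with hy
  have hsum : ∑ j, erfiProfile (max 0 (y j)) ≤ 0 := by
    rw [tracePotential, cfc_conjDiag hV, trace_conjDiag hV, Complex.ofReal_re] at hΨ
    simp only [erfiPotential_eq_mul, ← hr] at hΨ
    rw [← Finset.mul_sum] at hΨ
    have hκ : 0 < ε * √(T : ℝ) / d := by positivity
    have h := nonpos_of_mul_nonpos_right hΨ hκ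
    refine le_trans (le_of_eq (Finset.sum_congr rfl fun j _ => ?_)) h
    rw [max_mul_of_nonneg _ _ (inv_nonneg.2 hr0.le), zero_mul, ← div_eq_mul_inv]
  set w : Fin d → ℝ := fun j => max 0 (y j - 1) with hw
  -- The sum is at most `2 d`; rounding `2` up to `e` makes the additive constant in the Gibbs
  -- inequality equal to `1`.
  have hexp : ∑ j, Real.exp (w j ^ 2) ≤ d * Real.exp 1 := by
    have h1 : ∑ j, Real.exp (w j ^ 2) ≤ ∑ j, (2 + erfiProfile (max 0 (y j))) :=
      Finset.sum_le_sum fun j _ => exp_sq_le_erfiProfile (y j)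
    rw [Finset.sum_add_distrib] at h1
    simp only [Finset.sum_const, Finset.card_univ, Fintype.card_fin, nsmul_eq_mul] at h1
    have h2 : (2 : ℝ) ≤ Real.exp 1 := by linarith [Real.add_one_le_exp (1 : ℝ)]
    nlinarith
  have hvar := sum_overlap_mul_le_relEntropy hd hV hW hX hx1 (fun j => w j ^ 2) hexp
  have hmass : ∑ i, ∑ j, overlap W V i j * x i = 1 := by
    rw [← sum_eq_sum_overlap_left hW hV, hx1]
  set μ := ∑ i, ∑ j, overlap W V i j * (x i * w j) with hμ
  have hπ : ∀ i j, 0 ≤ overlap W V i j * x i := fun i j =>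
    mul_nonneg (overlap_nonneg _ _ _ _) (hX i)
  -- Nonnegativity of the variance of `w`.
  have hcs : μ ^ 2 ≤ E + 1 := by
    have h0 : 0 ≤ ∑ i, ∑ j, (overlap W V i j * x i) * (w j - μ) ^ 2 :=
      Finset.sum_nonneg fun i _ => Finset.sum_nonneg fun j _ =>
        mul_nonneg (hπ i j) (sq_nonneg _)
    have h1 : ∑ i, ∑ j, (overlap W V i j * x i) * (w j - μ) ^ 2
        = ∑ i, ∑ j, overlap W V i j * (x i * w j ^ 2) - 2 * μ * μ + μ ^ 2 * 1 := by
      rw [← hmass]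
      nth_rw 3 [hμ]
      simp only [Finset.mul_sum, ← Finset.sum_sub_distrib, ← Finset.sum_add_distrib]
      exact Finset.sum_congr rfl fun i _ => Finset.sum_congr rfl fun j _ => by ring
    linarith
  have hμle : μ ≤ √E + 1 := by
    refine abs_le_of_sq_le_sq' ?_ (by positivity) |>.2
    have := Real.sq_sqrt hE
    nlinarith [Real.sqrt_nonneg E]
  have hfrob : frob (conjDiag V s) (conjDiag W x)
      ≤ r * ∑ i, ∑ j, (overlap W V i j * x i + overlap W V i j * (x i * w j)) := by
    rw [frob_comm, frob_conjDiag_conjDiag]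
    simp only [Finset.mul_sum]
    refine Finset.sum_le_sum fun i _ => Finset.sum_le_sum fun j _ => ?_
    have h1 : s j ≤ r * (1 + w j) := by
      have h2 : y j ≤ 1 + w j := by linarith [le_max_right 0 (y j - 1)]
      have h3 : s j = r * y j := by simp only [hy]; field_simp
      rw [h3]
      exact mul_le_mul_of_nonneg_left h2 hr0.le
    have := mul_le_mul_of_nonneg_left h1 (hπ i j)
    linarith
  simp only [Finset.sum_add_distrib] at hfrob
  rw [hmass, ← hμ] at hfrob
  rw [← hreq]
  refine hfrob.trans (mul_le_mul_of_nonneg_left ?_ hr0.le)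
  linarith

theorem erfiLEA_play_mem_spectraplex {d : ℕ} {l : ℝ} (hd : 1 ≤ d) (hl : 0 < l) {T : ℕ}
    {G : ℕ → CMat d} (hG : ∀ t ∈ Finset.Icc 1 T, (G t).IsHermitian ∧ opNorm (G t) ≤ l) :
    ∀ t ∈ Finset.Icc 1 T, (erfiLEA d l).play G t ∈ spectraplex d := by
  intro t ht
  rw [Finset.mem_Icc] at ht
  have hS := (erfiState_spec hd hl hG (n := t - 1) (by omega)).1
  exact normalizedPos_mem_spectraplex hd (isHermitian_erfiBase _ _ hS)

theorem erfiLEA_regret_le {d : ℕ} {l : ℝ} (hd : 1 ≤ d) (hl : 0 < l) {T : ℕ} (hT : 1 ≤ T)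
    {G : ℕ → CMat d} (hG : ∀ t ∈ Finset.Icc 1 T, (G t).IsHermitian ∧ opNorm (G t) ≤ l)
    {X : CMat d} (hX : X ∈ spectraplex d) :
    regret G ((erfiLEA d l).play G) T X ≤
      l * √(T : ℝ) * (√(8 * relEntropy X (maxMixed d)) + 6 + 2 * √2) := by
  obtain ⟨hS, hΨ, hreg⟩ := erfiState_spec hd hl hG le_rfl
  refine (hreg X hX).trans
    ((frob_le_of_tracePotential_nonpos hd (by linarith) hT hS hX hΨ).trans ?_)
  have h8 : √(8 * relEntropy X (maxMixed d)) = 2 * √2 * √(relEntropy X (maxMixed d)) := by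
    rw [Real.sqrt_mul (by norm_num), show (8 : ℝ) = 2 ^ 2 * 2 by norm_num,
      Real.sqrt_mul (by norm_num), Real.sqrt_sq (by norm_num)]
  -- The argument yields the additive constant `4√2`, which is below `6 + 2√2`.
  have h2 : √2 ≤ 3 := by
    rw [Real.sqrt_le_left (by norm_num)]; norm_num
  rw [h8]
  have h3 : 0 ≤ l * √(T : ℝ) := by positivity
  have h4 : 2 * √2 * (√(relEntropy X (maxMixed d)) + 2)
      ≤ 2 * √2 * √(relEntropy X (maxMixed d)) + 6 + 2 * √2 := by linarith
  have := mul_le_mul_of_nonneg_left h4 h3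
  linarith

theorem erfiLEA_regret_le_const {d : ℕ} {l : ℝ} (hd : 1 ≤ d) (hl : 0 < l) {T : ℕ} (hT : 1 ≤ T)
    {G : ℕ → CMat d} (hG : ∀ t ∈ Finset.Icc 1 T, (G t).IsHermitian ∧ opNorm (G t) ≤ l)
    {X : CMat d} (hX : X ∈ spectraplex d) :
    regret G ((erfiLEA d l).play G) T X ≤
      (√8 + 6 + 2 * √2) * l * √(T * max 1 (relEntropy X (maxMixed d))) := by
  refine (erfiLEA_regret_le hd hl hT hG hX).trans ?_
  set E := relEntropy X (maxMixed d)
  rw [Real.sqrt_mul (Nat.cast_nonneg T), Real.sqrt_mul (by norm_num : (0 : ℝ) ≤ 8)]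
  have h1 : √E ≤ √(max 1 E) := Real.sqrt_le_sqrt (le_max_right _ _)
  have h2 : 1 ≤ √(max 1 E) := Real.one_le_sqrt.2 (le_max_left _ _)
  have h3 : √8 * √E + 6 + 2 * √2 ≤ (√8 + 6 + 2 * √2) * √(max 1 E) := by
    have := mul_le_mul_of_nonneg_left h1 (Real.sqrt_nonneg 8)
    have := mul_le_mul_of_nonneg_left h2 (show 0 ≤ 6 + 2 * √2 by positivity)
    linarith
  have := mul_le_mul_of_nonneg_left h3 (show 0 ≤ l * √(T : ℝ) by positivity)
  linarith

/-! ### Programs -/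

theorem EigOracle.vecs_mem {d : ℕ} (O : EigOracle d) {A : CMat d} (hA : A.IsHermitian) :
    O.vecs A ∈ Matrix.unitaryGroup (Fin d) ℂ := O.unitary A hA

theorem EigOracle.eq_conjDiag {d : ℕ} (O : EigOracle d) {A : CMat d} (hA : A.IsHermitian) :
    A = conjDiag (O.vecs A) (O.vals A) := O.spec A hA

theorem memAfter_mmwuProgram {d : ℕ} (O : EigOracle d) (η : ℕ → ℝ) (G : ℕ → CMat d)
    (hG : ∀ t, (G t).IsHermitian) (n : ℕ) :
    (mmwuProgram.memAfter O η G n).mat 2 = (mmwu d η).stateAfter G n ∧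
      ((mmwuProgram.memAfter O η G n).mat 2).IsHermitian := by
  induction n with
  | zero => exact ⟨rfl, Matrix.isHermitian_zero⟩
  | succ n ih =>
    have h : (mmwuProgram.memAfter O η G (n + 1)).mat 2
        = (mmwuProgram.memAfter O η G n).mat 2 + G (n + 1) := by
      rw [Program.memAfter]
      simp [mmwuProgram, execList, Instr.exec, Mem.receive, Mem.startRound]
    rw [h]
    refine ⟨?_, ih.2.add (hG _)⟩
    rw [ih.1]
    rfl

theorem mmwuProgram_implements {d : ℕ} (η : ℕ → ℝ) :
    mmwuProgram.Implements η (mmwu d η) := by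
  intro O G hG t _
  obtain ⟨h1, h2⟩ := memAfter_mmwuProgram O η G hG (t - 1)
  rw [Program.output, OnlineAlgorithm.play, ← h1]
  set m := mmwuProgram.memAfter O η G (t - 1)
  set S := m.mat 2 with hSdef
  have hV := O.vecs_mem h2
  set V := O.vecs S with hVdef
  set s := O.vals S with hsdef
  have hS : S = conjDiag V s := O.eq_conjDiag h2
  have hplay : (mmwu d η).predict t S
      = conjDiag V fun i => (∑ j, Real.exp (-η t * s j))⁻¹ * Real.exp (-η t * s i) := by
    have h : (-η t) • S = conjDiag V fun i => -η t * s i := by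
      conv_lhs => rw [hS]
      rw [conjDiag_smul]
    simp only [mmwu]
    rw [h, cfc_conjDiag hV, trace_conjDiag hV, Complex.ofReal_re, conjDiag_smul]
  rw [hplay]
  simp only [mmwuProgram, execList, List.foldl, Instr.exec, Mem.startRound, BinOp.eval, Fn.eval,
    Function.update_self, ne_eq, not_false_eq_true, Function.update_of_ne, Nat.reduceEqDiff,
    zero_ne_one, ← hSdef, ← hVdef, ← hsdef]
  rw [conjDiag]
  congr 3
  funext i
  congr 1
  simp [div_eq_inv_mul, mul_comm]

/-- The code that makes the prediction of the erfi algorithm, from the matrix `S_t` in register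
`2`; it leaves the eigenvectors of `S_t` in the matrix register `3` and the eigenvalues of the base
prediction in the vector register `0`. -/
def erfiPredictCode : List Instr :=
  [.eig 0 3 2,
   .const 3 2,
   .scalOp 4 .mul 3 2,
   .scalOp 5 .mul 4 4,
   .scalOp 5 .mul 3 5,
   .scalOp 5 .mul 5 0,
   .scalFn 5 .sqrt 5,
   .scalFn 6 .sqrt 0,
   .scalOp 6 .mul 4 6,
   .scalOp 6 .div 6 1,
   .scalOp 7 .mul 3 4,
   .scalOp 6 .div 6 7,
   .vecFill 1 4,
   .vecOp 2 .add 0 1,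
   .vecOp 3 .sub 0 1,
   .vecFill 1 5,
   .vecOp 2 .div 2 1,
   .vecOp 3 .div 3 1,
   .vecFill 1 3,
   .vecFn 4 .erfi 2,
   .vecOp 4 .mul 2 4,
   .vecOp 4 .mul 1 4,
   .vecOp 2 .mul 2 2,
   .vecFn 2 .exp 2,
   .vecOp 2 .sub 4 2,
   .vecFn 4 .erfi 3,
   .vecOp 4 .mul 3 4,
   .vecOp 4 .mul 1 4,
   .vecOp 3 .mul 3 3,
   .vecFn 3 .exp 3,
   .vecOp 3 .sub 4 3,
   .vecOp 0 .sub 2 3,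
   .vecFill 1 6,
   .vecOp 0 .mul 1 0]

/-- The code that normalizes the positive part of the base prediction. -/
def normalizeCode : List Instr :=
  [.const 3 0,
   .vecFill 1 3,
   .vecOp 2 .max 1 0,
   .vecSum 4 2,
   .scalOp 5 .lt 3 4,
   .const 6 1,
   .scalOp 5 .sub 6 5,
   .scalOp 5 .div 5 1,
   .vecFill 3 4,
   .vecOp 2 .div 2 3,
   .vecFill 3 5,
   .vecOp 2 .add 2 3,
   .synth 0 3 2]

/-- The code that subtracts the surrogate loss from the matrix register `2`. -/
def surrogateCode : List Instr :=
  [.matInner 4 1 0,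
   .matOne 4,
   .matSmul 4 4 4,
   .matSub 1 1 4,
   .vecOp 2 .min 1 0,
   .vecSum 5 2,
   .scalOp 5 .sub 3 5,
   .vecFill 3 5,
   .vecOp 2 .div 2 3,
   .synth 4 3 2,
   .matInner 4 1 4,
   .scalOp 4 .min 3 4,
   .matSmul 4 4 4,
   .matSub 1 1 4,
   .matSub 2 2 1]

/-- The program of the erfi algorithm. -/
def erfiProgram : Program where
  predict := erfiPredictCode ++ normalizeCode
  update := surrogateCode

theorem execList_erfiPredictCode {d : ℕ} (O : EigOracle d) (m : Mem d) :
    (execList O erfiPredictCode m).vec 0 = (fun i =>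
      2 * m.scal 2 * √(m.scal 0) / m.scal 1 / (2 * (2 * m.scal 2)) *
        (erfiProfile ((O.vals (m.mat 2) i + 2 * m.scal 2)
            / √(2 * (2 * m.scal 2 * (2 * m.scal 2)) * m.scal 0))
          - erfiProfile ((O.vals (m.mat 2) i - 2 * m.scal 2)
            / √(2 * (2 * m.scal 2 * (2 * m.scal 2)) * m.scal 0)))) ∧
      (execList O erfiPredictCode m).mat 2 = m.mat 2 ∧
      (execList O erfiPredictCode m).mat 3 = O.vecs (m.mat 2) ∧
      (execList O erfiPredictCode m).scal 1 = m.scal 1 := by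
  refine ⟨?_, ?_, ?_, ?_⟩
  · funext i
    simp [erfiPredictCode, execList, Instr.exec, BinOp.eval, Fn.eval, erfiProfile, mul_assoc, sq]
  all_goals simp [erfiPredictCode, execList, Instr.exec]

/-- The fallback needs no branch: if the sum of positive parts is zero, the quotients are zero and
the complement of the comparison bit, divided by `d`, supplies the uniform spectrum. The zeroed
registers are recorded because the update code reuses them. -/
theorem execList_normalizeCode {d : ℕ} (O : EigOracle d) (m : Mem d) {a : Fin d → ℝ} {V : CMat d}
    (hV : V ∈ Matrix.unitaryGroup (Fin d) ℂ) (ha : m.vec 0 = a) (hVm : m.mat 3 = V)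
    (hd : m.scal 1 = d) :
    (execList O normalizeCode m).mat 0 = normalizedPos (conjDiag V a) ∧
      (execList O normalizeCode m).mat 2 = m.mat 2 ∧
      (execList O normalizeCode m).mat 3 = V ∧
      (execList O normalizeCode m).vec 0 = a ∧
      (execList O normalizeCode m).vec 1 = 0 ∧
      (execList O normalizeCode m).scal 3 = 0 := by
  refine ⟨?_, ?_, ?_, ?_, ?_, ?_⟩
  · have h : (execList O normalizeCode m).mat 0 = conjDiag V fun i =>
        max 0 (a i) / (∑ j, max 0 (a j)) + (1 - (if 0 < ∑ j, max 0 (a j) then 1 else 0)) / d := by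
      simp [normalizeCode, execList, Instr.exec, BinOp.eval, conjDiag, ha, hVm, hd]
    have hnn : 0 ≤ ∑ j, max 0 (a j) := Finset.sum_nonneg fun j _ => le_max_left _ _
    rw [h, normalizedPos]
    split_ifs with h1 h2 h2
    · rw [posPart_conjDiag_eq_zero_iff hV] at h2
      exact absurd h2 h1.ne'
    · rw [posPart_conjDiag hV, trace_conjDiag hV, Complex.ofReal_re, conjDiag_smul]
      congr 1
      funext i
      rw [sub_self, zero_div, add_zero, div_eq_inv_mul]
    · rw [posPart_conjDiag_eq_zero_iff hV] at h2
      rw [h2, maxMixed, ← conjDiag_const hV]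
      simp
    · rw [posPart_conjDiag_eq_zero_iff hV] at h2
      exact absurd (le_antisymm (not_lt.1 h1) hnn) h2
  · simp [normalizeCode, execList, Instr.exec]
  · simp [normalizeCode, execList, Instr.exec, hVm]
  · simp [normalizeCode, execList, Instr.exec, ha]
  · funext i
    simp [normalizeCode, execList, Instr.exec]
  · simp [normalizeCode, execList, Instr.exec]

theorem execList_surrogateCode {d : ℕ} (O : EigOracle d) (m : Mem d) {a : Fin d → ℝ}
    {V S G : CMat d} (hV : V ∈ Matrix.unitaryGroup (Fin d) ℂ) (ha : m.vec 0 = a)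
    (hVm : m.mat 3 = V) (h0 : m.mat 0 = normalizedPos (conjDiag V a)) (h1 : m.mat 1 = G)
    (h2 : m.mat 2 = S) (hv1 : m.vec 1 = 0) (hs3 : m.scal 3 = 0) :
    (execList O surrogateCode m).mat 2 = S - surrogateLoss (conjDiag V a) G := by
  have hU : negDirection (conjDiag V a)
      = conjDiag V fun i => min 0 (a i) / (0 - ∑ j, min 0 (a j)) := by
    rw [negDirection_conjDiag hV]
    congr 1
    funext i
    rw [abs_of_nonpos (Finset.sum_nonpos fun i _ => min_le_left _ _), zero_sub, div_eq_inv_mul]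
  rw [surrogateLoss_eq (conjDiag_isHermitian V a), hU]
  simp [surrogateCode, execList, Instr.exec, BinOp.eval, conjDiag, ha, hVm, h0, h1, h2, hv1, hs3]

theorem execList_predict_erfiProgram {d : ℕ} (O : EigOracle d) (l : ℝ) (t : ℕ) (m : Mem d)
    (hS : (m.mat 2).IsHermitian) :
    ∃ a : Fin d → ℝ, ∃ V ∈ Matrix.unitaryGroup (Fin d) ℂ,
      erfiBase d (2 * l) t (m.mat 2) = conjDiag V a ∧
      (execList O erfiProgram.predict (m.startRound t l)).mat 0 = normalizedPos (conjDiag V a) ∧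
      (execList O erfiProgram.predict (m.startRound t l)).mat 2 = m.mat 2 ∧
      (execList O erfiProgram.predict (m.startRound t l)).mat 3 = V ∧
      (execList O erfiProgram.predict (m.startRound t l)).vec 0 = a ∧
      (execList O erfiProgram.predict (m.startRound t l)).vec 1 = 0 ∧
      (execList O erfiProgram.predict (m.startRound t l)).scal 3 = 0 := by
  obtain ⟨h1, h2, h3, h4⟩ := execList_erfiPredictCode O (m.startRound t l)
  have hV := O.vecs_mem hS
  have e2 : (m.startRound t l).mat 2 = m.mat 2 := rfl
  have s0 : (m.startRound t l).scal 0 = t := by simp [Mem.startRound]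
  have s1 : (m.startRound t l).scal 1 = d := by simp [Mem.startRound]
  have s2 : (m.startRound t l).scal 2 = l := by simp [Mem.startRound]
  rw [e2, s0, s1, s2] at h1
  rw [e2] at h2 h3
  rw [s1] at h4
  obtain ⟨k1, k2, k3, k4, k5, k6⟩ := execList_normalizeCode O _ hV h1 h3 h4
  refine ⟨_, O.vecs (m.mat 2), hV, ?_, k1, k2.trans h2, k3, k4, k5, k6⟩
  conv_lhs => rw [O.eq_conjDiag hS]
  rw [erfiBase_conjDiag hV]
  congr 1
  funext i
  rw [erfiPotential_eq, erfiPotential_eq, ← mul_sub, sq]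
  ring

/-- Hermiticity belongs to the induction, as the oracle promises nothing for other matrices. -/
theorem memAfter_erfiProgram {d : ℕ} (O : EigOracle d) (l : ℝ) (G : ℕ → CMat d)
    (hG : ∀ t, (G t).IsHermitian) (n : ℕ) :
    (erfiProgram.memAfter O (fun _ => l) G n).mat 2 = erfiState d l G n ∧
      ((erfiProgram.memAfter O (fun _ => l) G n).mat 2).IsHermitian := by
  induction n with
  | zero => exact ⟨rfl, Matrix.isHermitian_zero⟩
  | succ n ih =>
    obtain ⟨ih1, ih2⟩ := ih
    obtain ⟨a, V, hV, hA, k0, k2, k3, k4, k5, k6⟩ :=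
      execList_predict_erfiProgram O l (n + 1) (erfiProgram.memAfter O (fun _ => l) G n) ih2
    have hrun : erfiProgram.memAfter O (fun _ => l) G (n + 1)
        = execList O surrogateCode (Mem.receive (execList O erfiProgram.predict
          ((erfiProgram.memAfter O (fun _ => l) G n).startRound (n + 1) l)) (G (n + 1))) := rfl
    have h' : (erfiProgram.memAfter O (fun _ => l) G (n + 1)).mat 2 = erfiState d l G (n + 1) := by
      rw [hrun, erfiState_succ, ← ih1, hA]
      generalize execList O erfiProgram.predict
        ((erfiProgram.memAfter O (fun _ => l) G n).startRound (n + 1) l) = m' at k0 k2 k3 k4 k5 k6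
      exact execList_surrogateCode O (m'.receive (G (n + 1))) hV k4
        (by simpa [Mem.receive] using k3) (by simpa [Mem.receive] using k0) (by simp [Mem.receive])
        (by simpa [Mem.receive] using k2) k5 k6
    refine ⟨h', ?_⟩
    rw [h', erfiState_succ, surrogateLoss_eq (isHermitian_erfiBase _ _ (ih1 ▸ ih2))]
    have hU := (negDirection_spec (isHermitian_erfiBase (2 * l) (n + 1) (ih1 ▸ ih2))).1.1.neg
    rw [neg_neg] at hU
    exact (ih1 ▸ ih2).sub (((hG _).sub (isHermitian_smul Matrix.isHermitian_one _)).sub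
      (isHermitian_smul hU _))

theorem erfiProgram_implements (d : ℕ) (l : ℝ) :
    erfiProgram.Implements (fun _ => l) (erfiLEA d l) := by
  intro O G hG t _
  obtain ⟨h1, h2⟩ := memAfter_erfiProgram O l G hG (t - 1)
  obtain ⟨a, V, _, hA, k0, _⟩ :=
    execList_predict_erfiProgram O l t (erfiProgram.memAfter O (fun _ => l) G (t - 1)) h2
  rw [play_erfiLEA, ← h1, hA]
  exact k0

/-! ### Time and memory of the two programs -/

theorem mmwuProgram_time (d : ℕ) (p : Prices) :
    mmwuProgram.time d p = p.eig + p.synth + 2 + 5 * d + d ^ 2 + d * p.fn := by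
  simp only [Program.time, mmwuProgram, List.cons_append, List.nil_append, List.map, List.sum_cons,
    List.sum_nil, Instr.time]
  ring

theorem erfiProgram_time_eq (d : ℕ) (p : Prices) :
    erfiProgram.time d p
      = p.eig + 2 * p.synth + 16 + 29 * d + 8 * d ^ 2 + 4 * (d * p.fn) + 2 * p.fn := by
  simp only [Program.time, erfiProgram, erfiPredictCode, normalizeCode, surrogateCode,
    List.cons_append, List.nil_append, List.map, List.sum_cons, List.sum_nil, Instr.time]
  ring

theorem erfiProgram_time {d : ℕ} (hd : 1 ≤ d) (p : Prices) :
    erfiProgram.time d p ≤ 100 * mmwuProgram.time d p ∧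
      mmwuProgram.time d p ≤ 100 * erfiProgram.time d p := by
  -- The two scalar square roots cost `2 * p.fn`, which the entrywise exponential of the MMWU
  -- program dominates only for `d ≥ 1`.
  have h2 : p.fn ≤ d * p.fn := Nat.le_mul_of_pos_left _ hd
  rw [mmwuProgram_time, erfiProgram_time_eq]
  generalize d ^ 2 = a at *
  generalize d * p.fn = b at *
  omega

set_option maxRecDepth 20000 in
theorem erfiProgram_space (d : ℕ) :
    erfiProgram.space d ≤ 100 * mmwuProgram.space d ∧
      mmwuProgram.space d ≤ 100 * erfiProgram.space d := by
  have h1 : (regsOf Instr.scalRegs (erfiProgram.predict ++ erfiProgram.update)).card = 8 := by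
    rfl
  have h2 : (regsOf Instr.vecRegs (erfiProgram.predict ++ erfiProgram.update)).card = 5 := by
    rfl
  have h3 : (regsOf Instr.matRegs (erfiProgram.predict ++ erfiProgram.update)).card = 5 := by
    rfl
  have h4 : (regsOf Instr.scalRegs (mmwuProgram.predict ++ mmwuProgram.update)).card = 2 := by
    rfl
  have h5 : (regsOf Instr.vecRegs (mmwuProgram.predict ++ mmwuProgram.update)).card = 2 := by
    rfl
  have h6 : (regsOf Instr.matRegs (mmwuProgram.predict ++ mmwuProgram.update)).card = 4 := by
    rfl
  rw [Program.space, Program.space, h1, h2, h3, h4, h5, h6]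
  generalize d ^ 2 = a
  omega

end MatrixLEA

end

theorem theorem4p4 :
    (∀ (d : ℕ) (l : ℝ), 1 ≤ d → 0 < l → ∀ (T : ℕ), 1 ≤ T → ∀ G : ℕ → CMat d,
      (∀ t ∈ Finset.Icc 1 T, (G t).IsHermitian ∧ opNorm (G t) ≤ l) →
        (∀ t ∈ Finset.Icc 1 T, (erfiLEA d l).play G t ∈ spectraplex d) ∧
        ∀ X ∈ spectraplex d,
          regret G ((erfiLEA d l).play G) T X ≤
            l * √(T : ℝ) * (√(8 * relEntropy X (maxMixed d)) + 6 + 2 * √2)) ∧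
    (∃ C : ℝ, ∀ (d : ℕ) (l : ℝ), 1 ≤ d → 0 < l → ∀ (T : ℕ), 1 ≤ T → ∀ G : ℕ → CMat d,
      (∀ t ∈ Finset.Icc 1 T, (G t).IsHermitian ∧ opNorm (G t) ≤ l) →
        ∀ X ∈ spectraplex d,
          regret G ((erfiLEA d l).play G) T X ≤
            C * l * √(T * max 1 (relEntropy X (maxMixed d)))) ∧
    (∀ (d : ℕ) (η : ℕ → ℝ), 1 ≤ d → mmwuProgram.Implements η (mmwu d η)) ∧
    (∃ (P : Program) (C : ℕ),
      (∀ (d : ℕ) (l : ℝ), 1 ≤ d → 0 < l → P.Implements (fun _ => l) (erfiLEA d l)) ∧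
      ∀ (d : ℕ), 1 ≤ d →
        (∀ p : Prices, P.time d p ≤ C * mmwuProgram.time d p ∧
          mmwuProgram.time d p ≤ C * P.time d p) ∧
        P.space d ≤ C * mmwuProgram.space d ∧ mmwuProgram.space d ≤ C * P.space d) :=
  ⟨fun _ _ hd hl _ hT _ hG => ⟨erfiLEA_play_mem_spectraplex hd hl hG,
      fun _ hX => erfiLEA_regret_le hd hl hT hG hX⟩,
    ⟨_, fun _ _ hd hl _ hT _ hG _ hX => erfiLEA_regret_le_const hd hl hT hG hX⟩,
    fun _ η _ => mmwuProgram_implements η,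
    ⟨erfiProgram, 100, fun d l _ _ => erfiProgram_implements d l,
      fun d hd => ⟨fun p => erfiProgram_time hd p, erfiProgram_space d⟩⟩⟩
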